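/- All graphs are finite and may have loops and parallel edges unless called simple. A \emph{biased graph} $(G,\mathcal B)$ is a graph $G$ with a set $\mathcal B$ of cycles of $G$ (the \emph{balanced} cycles) such that no theta subgraph of $G$ (two distinct vertices $x,y$ together with three internally disjoint $x$--$y$ paths) has exactly two of its three cycles in $\mathcal B$. For a group $\Gamma$, $(G,\mathcal B)$ is \emph{$\Gamma$-labellable} if there are an orientation of $G$ and a map $\phi:E(G)\to\Gamma$ such that $\mathcal B$ is exactly the set of cycles $C$ for which a simple closed walk $e_1,\dots,e_\ell$ around $C$ satisfies $\prod_{i=1}^{\ell}\phi(e_i)^{\epsilon_i}=1$, where $\epsilon_i=1$ if $e_i$ is traversed forward and $\epsilon_i=-1$ if it is traversed backward; it is \emph{group-labellable} if it is $\Gamma$-labellable for some group $\Gamma$. Deleting an edge $e$ gives $(G\setminus e,\{C\in\mathcal B: e\notin E(C)\})$. Contracting a non-loop edge $e$ gives $G/e$, where a cycle $C$ of $G/e$ is balanced if $C\in\mathcal B$ or $E(C)\cup\{e\}$ is the edge set of a cycle in $\mathcal B$. \textbf{Theorem.} Let $t$ be a positive integer and let $G$ be a finite simple graph embedded in the plane,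 with a colouring of its vertices by $t$ colours, such that (1) $G$ is a subdivision of a $3$-connected graph (on at least four vertices); (2) every colour appears exactly once on every face, including the infinite face; (3) every cycle of $G$ of length at most $t$ is the boundary of a face. Let $\widetilde G$ be the graph obtained from $G$ by identifying each colour class to a single vertex (keeping all edges), and let $\mathcal B$ be the set of cycles of $\widetilde G$ whose edge sets are the boundaries of the finite faces of $G$. Then $(\widetilde G,\mathcal B)$ is a biased graph without loops, and it is not group-labellable. Moreover, for every edge $e$ of $\widetilde G$ and every infinite group $\Gamma$, both the biased graph obtained from $(\widetilde G,\mathcal B)$ by deleting $e$ and the one obtained by contracting $e$ are $\Gamma$-labellable. -/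

import Mathlib

open scoped Graph

/-! ### Walks, paths, cycles and theta subgraphs of multigraphs -/

namespace Graph

variable {α β α' β' : Type*}

/-- Walks in a multigraph, recording the edges that are traversed. -/
inductive Walk (G : Graph α β) : α → α → Type _
  | nil {u : α} (hu : u ∈ V(G)) : Walk G u u
  | cons {u v w : α} (e : β) (h : G.IsLink e u v) (p : Walk G v w) : Walk G u w

namespace Walk

variable {G : Graph α β}

/-- The sequence of edges of a walk. -/
def edges : {u v : α} → G.Walk u v → List β
  | _, _, nil _ => []
  | _, _, cons e _ p => e :: p.edges

/-- The sequence of vertices of a walk, both ends included. -/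
def support : {u v : α} → G.Walk u v → List α
  | u, _, nil _ => [u]
  | u, _, cons _ _ p => u :: p.support

/-- The set of edges of a walk. -/
def edgeSet {u v : α} (p : G.Walk u v) : Set β := {e | e ∈ p.edges}

/-- A path: no repeated vertex. -/
def IsPath {u v : α} (p : G.Walk u v) : Prop := p.support.Nodup

/-- A simple closed walk around a cycle: it is not trivial and, apart from the return to the
start, repeats neither an edge nor a vertex. A loop is a cycle of length one and two parallel
edges form a cycle of length two. -/
structure IsCycle {u : α} (p : G.Walk u u) : Prop where
  ne_nil : p.edges ≠ []
  edges_nodup : p.edges.Nodup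
  support_tail_nodup : p.support.tail.Nodup

/-- Two walks from `x` to `y` are internally disjoint if they have no common edge and no common
vertex other than `x` and `y`. -/
def InternallyDisjoint {x y : α} (p q : G.Walk x y) : Prop :=
  (∀ e ∈ p.edges, e ∉ q.edges) ∧ ∀ z ∈ p.support, z ∈ q.support → z = x ∨ z = y

end Walk

/-- `C` is the edge set of a cycle of `G`. Cycles are identified with their edge sets. -/
def IsCycleSet (G : Graph α β) (C : Set β) : Prop :=
  ∃ (u : α) (p : G.Walk u u), p.IsCycle ∧ p.edgeSet = C

/-! ### Biased graphs, group labellings and minors -/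

/-- `(G, 𝓑)` is a biased graph: `𝓑` is a set of cycles of `G`, and if two of the three cycles of a
theta subgraph belong to `𝓑`, then so does the third (the three paths may be taken in any
order). -/
structure IsBiased (G : Graph α β) (𝓑 : Set (Set β)) : Prop where
  isCycleSet : ∀ C ∈ 𝓑, G.IsCycleSet C
  theta : ∀ (x y : α) (p q r : G.Walk x y), x ≠ y → p.IsPath → q.IsPath → r.IsPath →
    p.InternallyDisjoint q → p.InternallyDisjoint r → q.InternallyDisjoint r →
    p.edgeSet ∪ q.edgeSet ∈ 𝓑 → p.edgeSet ∪ r.edgeSet ∈ 𝓑 → q.edgeSet ∪ r.edgeSet ∈ 𝓑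

/-- A group labelling: an orientation of the edges, given by the tail of each edge, together with
a label in `Γ` for every edge. -/
structure GroupLabelling (G : Graph α β) (Γ : Type*) where
  tail : E(G) → α
  inc_tail : ∀ e : E(G), G.Inc e (tail e)
  label : E(G) → Γ

open Classical in
/-- The value of a group labelling on a walk: the ordered product of the labels, inverted for the
edges that are traversed backward. (For a loop the direction of traversal is immaterial to
whether the cycle that it forms has value `1`; it is read as forward.) -/
noncomputable def Walk.gain {G : Graph α β} {Γ : Type*} [Group Γ] (φ : G.GroupLabelling Γ) :
    {u v : α} → G.Walk u v → Γ
  | _, _, .nil _ => 1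
  | u, _, .cons e h p =>
      (if u = φ.tail ⟨e, h.edge_mem⟩ then φ.label ⟨e, h.edge_mem⟩
        else (φ.label ⟨e, h.edge_mem⟩)⁻¹) * Walk.gain φ p

/-- The cycles around which some simple closed walk has value `1`. -/
def GroupLabelling.balanced {G : Graph α β} {Γ : Type*} [Group Γ] (φ : G.GroupLabelling Γ) :
    Set (Set β) :=
  {C | ∃ (u : α) (p : G.Walk u u), p.IsCycle ∧ p.edgeSet = C ∧ p.gain φ = 1}

/-- `(G, 𝓑)` is `Γ`-labellable. -/
def Labellable (G : Graph α β) (𝓑 : Set (Set β)) (Γ : Type*) [Group Γ] : Prop :=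
  ∃ φ : G.GroupLabelling Γ, φ.balanced = 𝓑

/-- The balanced cycles after deletion of `e` (the graph being `G.deleteEdges {e}`). -/
def deleteBalanced (𝓑 : Set (Set β)) (e : β) : Set (Set β) := {C ∈ 𝓑 | e ∉ C}

open Classical in
/-- Contraction of an edge `e` with ends `x ≠ y`: delete `e` and identify `y` with `x`. -/
noncomputable def contract (G : Graph α β) (e : β) (x y : α) : Graph α β :=
  (G.deleteEdges {e}).map (fun z => if z = y then x else z)

/-- The balanced cycles after contraction of an edge `e` with ends `x ≠ y`: the cycles `C` of the
contracted graph with `C ∈ 𝓑` or `C ∪ {e} ∈ 𝓑`. -/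
def contractBalanced (G : Graph α β) (𝓑 : Set (Set β)) (e : β) (x y : α) : Set (Set β) :=
  {C | (G.contract e x y).IsCycleSet C ∧ (C ∈ 𝓑 ∨ insert e C ∈ 𝓑)}

/-! ### Subdivisions and 3-connectivity -/

/-- A (loopless, possibly with parallel edges) graph is 3-connected if it has at least four
vertices and remains connected after removal of any at most two vertices. -/
structure IsThreeConnected (H : Graph α β) : Prop where
  loopless : H.Loopless
  four_le_card : 4 ≤ V(H).encard
  connected : ∀ X : Set α, X.encard ≤ 2 → ∀ x ∈ V(H) \ X, ∀ y ∈ V(H) \ X,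
    Nonempty ((H.deleteVerts X).Walk x y)

/-- `G` is a subdivision of the loopless graph `H`: the edges of `H` are replaced by internally
disjoint paths between their ends, and these make up the whole of `G`. -/
structure Subdivision (G : Graph α β) (H : Graph α' β') where
  /-- The position in `G` of a vertex of `H`. -/
  branch : α' → α
  branch_mem : ∀ x ∈ V(H), branch x ∈ V(G)
  branch_injOn : Set.InjOn branch V(H)
  /-- The two ends of an edge of `H`. -/
  left : E(H) → α'
  right : E(H) → α'
  isLink : ∀ f : E(H), H.IsLink f (left f) (right f)
  /-- The path that replaces an edge of `H`. -/
  path : ∀ f : E(H), G.Walk (branch (left f)) (branch (right f))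
  isPath : ∀ f, (path f).IsPath
  branch_mem_support : ∀ f, ∀ x ∈ V(H), branch x ∈ (path f).support → x = left f ∨ x = right f
  support_disjoint : ∀ f g, f ≠ g → ∀ v ∈ (path f).support, v ∈ (path g).support →
    ∃ x ∈ V(H), branch x = v
  edges_disjoint : ∀ f g, f ≠ g → ∀ e ∈ (path f).edges, e ∉ (path g).edges
  vertex_cover : ∀ v ∈ V(G), (∃ x ∈ V(H), branch x = v) ∨ ∃ f, v ∈ (path f).support
  edge_cover : ∀ e ∈ E(G), ∃ f, e ∈ (path f).edges

end Graph

/-! ### Plane embeddings -/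

/-- A rotation system: a cyclic order on the darts leaving each vertex. -/
structure RotationSystem {V : Type*} (G : SimpleGraph V) where
  /-- The next dart around the initial vertex. -/
  next : Equiv.Perm G.Dart
  fst_next : ∀ d, (next d).fst = d.fst
  sameCycle : ∀ d d' : G.Dart, d.fst = d'.fst → next.SameCycle d d'

namespace RotationSystem

variable {V : Type*} {G : SimpleGraph V} (R : RotationSystem G)

/-- Face tracing: from `d`, go to the terminal vertex of `d` and leave it by the dart that follows
the reverse of `d` in the rotation there. -/
def facePerm : Equiv.Perm G.Dart :=
  (SimpleGraph.Dart.symm_involutive (G := G)).toPerm.trans R.next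

/-- The faces are the orbits of face tracing. -/
def Face : Type _ := Quotient (Equiv.Perm.SameCycle.setoid R.facePerm)

/-- The face whose boundary walk traverses the dart `d`. -/
def face (d : G.Dart) : R.Face := Quotient.mk (Equiv.Perm.SameCycle.setoid R.facePerm) d

/-- The edges on the boundary of a face. -/
def boundary (F : R.Face) : Set (Sym2 V) := {e | ∃ d : G.Dart, R.face d = F ∧ d.edge = e}

end RotationSystem

/-- A connected graph with at least one edge embedded in the plane, in the usual combinatorial
description: a rotation system that satisfies Euler's formula for the sphere, `|V| - |E| + |F| = 2`,
and one face that is selected as the infinite face. -/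
structure PlaneEmbedding {V : Type*} (G : SimpleGraph V) extends RotationSystem G where
  connected : G.Connected
  euler : Nat.card V + Nat.card toRotationSystem.Face = Nat.card G.edgeSet + 2
  /-- The infinite face. -/
  outer : toRotationSystem.Face

/-- The edge sets of the boundaries of the finite faces. -/
def PlaneEmbedding.finiteFaces {V : Type*} {G : SimpleGraph V} (P : PlaneEmbedding G) :
    Set (Set (Sym2 V)) :=
  {C | ∃ F : P.Face, F ≠ P.outer ∧ C = P.boundary F}

/-- The multigraph obtained from `G` by identifying every colour class to a single vertex; its
edges are those of `G`. -/
def SimpleGraph.identifyColours {V : Type*} {t : ℕ} (G : SimpleGraph V) (col : V → Fin t) :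
    Graph (Fin t) (Sym2 V) :=
  (Graph.ofSimpleGraph G).map col

/-!
*The minors are labellable.* Give the dart `d` of `G` the label `(h d.fst)⁻¹ * γ ^ ψ d * h d.snd`.
In the product around a cycle of the identified graph the potential `h` cancels where consecutive
darts meet in `G`, and survives where they only have ends of the same colour. For generic `h` the
balanced cycles are therefore the cycles of `G` with `∑ ψ = 0`. Being cycles of length at most `t`,
the candidates bound faces, so `ψ` only has to tell the finite faces from the outer one: take a flow
in the dual graph that leaves the outer face. It has to end at a face that is not a cycle of the
minor. After deletion of an edge `ε` such a face is one at `ε`; after contraction, where `h` lives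
on the vertices of `G / ε` and only the faces at `ε` remain cycles, it is any other.

*The graph itself is not labellable.* If all finite faces are balanced then, the sphere minus a
point being simply connected, the labelling comes from a potential on the vertices of `G`, and the
outer face is balanced as well. For simple connectedness take a spanning tree of `G`; by Euler's
formula the other edges form a spanning tree of the dual graph, and peeling off its leaves shows one
edge after another to have trivial label.

*The graph is biased.* A face has `t` edges, so it spans the identified graph. If two cycles of a
theta subgraph bound faces, each of the paths they do not share is therefore a single edge. These
two edges have the same ends in `G`, which is absurd.
-/

/-! ### Generic potentials -/

section CyclicProd

variable {Γ : Type*} [Group Γ] {n : ℕ}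

/-- The product `F 0 * F 1 * ⋯ * F (n - 1)`, in this order, of a family of group elements indexed
by the vertices of an `n`-cycle. -/
def cyclicProd (F : ZMod n → Γ) : Γ := ((List.range n).map fun i : ℕ => F i).prod

lemma eq_of_prod_map_eq {ι : Type*} {F F' : ι → Γ} {l : List ι} (hl : l.Nodup) {j : ι} (hj : j ∈ l)
    (h : ∀ i ∈ l, i ≠ j → F i = F' i) (hp : (l.map F).prod = (l.map F').prod) : F j = F' j := by
  obtain ⟨s, t, rfl⟩ := List.append_of_mem hj
  have hs : s.map F = s.map F' := List.map_congr_left fun i hi =>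
    h i (by simp [hi]) fun hij => (List.nodup_middle.1 hl).notMem (by simp [← hij, hi])
  have ht : t.map F = t.map F' := List.map_congr_left fun i hi =>
    h i (by simp [hi]) fun hij => (List.nodup_middle.1 hl).notMem (by simp [← hij, hi])
  simpa [hs, ht] using hp

lemma eq_of_cyclicProd_eq [NeZero n] {F F' : ZMod n → Γ} {j : ZMod n}
    (h : ∀ i, i ≠ j → F i = F' i) (hp : cyclicProd F = cyclicProd F') : F j = F' j := by
  have := eq_of_prod_map_eq (F := fun i : ℕ => F i) (F' := fun i : ℕ => F' i) (j := j.val)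
    List.nodup_range (List.mem_range.2 j.val_lt) (fun i hi hij => h i fun hc => hij ?_) hp
  · simpa using this
  · rw [← hc, ZMod.val_natCast_of_lt (List.mem_range.1 hi)]

lemma prod_range_regroup (a b g : ℕ → Γ) (n : ℕ) :
    ((List.range n).map fun i => (a i)⁻¹ * g i * b i).prod =
      (a 0)⁻¹ * ((List.range n).map fun i => g i * (b i * (a (i + 1))⁻¹)).prod * a n := by
  induction n with
  | zero => simp
  | succ n ih => rw [List.prod_range_succ, List.prod_range_succ, ih]; group

lemma cyclicProd_regroup (a b g : ZMod n → Γ) :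
    cyclicProd (fun i => (a i)⁻¹ * g i * b i) =
      (a 0)⁻¹ * cyclicProd (fun i => g i * (b i * (a (i + 1))⁻¹)) * a 0 := by
  simpa [cyclicProd] using prod_range_regroup (fun i => a i) (fun i => b i) (fun i => g i) n

lemma cyclicProd_zpow [NeZero n] (γ : Γ) (s : ZMod n → ℤ) :
    cyclicProd (fun i => γ ^ s i) = γ ^ ∑ i, s i := by
  have hsum : ∑ i, s i = ∑ i ∈ Finset.range n, s i :=
    (Finset.sum_nbij' (fun i : ℕ => (i : ZMod n)) ZMod.val (by simp) (by simp [ZMod.val_lt])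
      (fun i hi => ZMod.val_natCast_of_lt (Finset.mem_range.1 hi)) (by simp) (by simp)).symm
  have hprod : ∀ m : ℕ, ((List.range m).map fun i : ℕ => γ ^ s i).prod =
      γ ^ ∑ i ∈ Finset.range m, s i := by
    intro m
    induction m with
    | zero => simp
    | succ m ih => rw [List.prod_range_succ, ih, Finset.sum_range_succ, zpow_add]
  rw [hsum, cyclicProd, hprod]

end CyclicProd

/-- Words in finitely many variables are avoided one variable at a time: once the other variables
are fixed, each word excludes at most one value of the last variable of its support. -/
lemma exists_forall_word_ne {X ι Γ Δ : Type*} [Finite X] [Finite ι] [Infinite Γ] [DecidableEq X]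
    (word : ι → (X → Γ) → Δ) (δ : Δ) (supp : ι → Set X) (hne : ∀ i, (supp i).Nonempty)
    (hindep : ∀ i, ∀ v ∉ supp i, ∀ h x, word i (Function.update h v x) = word i h)
    (hinj : ∀ i, ∀ v ∈ supp i, ∀ h, Function.Injective fun x => word i (Function.update h v x)) :
    ∃ h : X → Γ, ∀ i, word i h ≠ δ := by
  have key : ∀ s : Finset X, ∃ h : X → Γ, ∀ i, supp i ⊆ s → word i h ≠ δ := by
    intro s
    induction s using Finset.induction_on with
    | empty =>
      exact ⟨fun _ => Classical.arbitrary Γ, fun i hi =>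
        absurd (Set.subset_empty_iff.1 (Finset.coe_empty ▸ hi)) (hne i).ne_empty⟩
    | insert v s _ ih =>
      obtain ⟨h, hh⟩ := ih
      have hfin : (⋃ i ∈ {i | v ∈ supp i}, {x | word i (Function.update h v x) = δ}).Finite :=
        Set.Finite.biUnion (Set.toFinite _) fun i hi => Set.Subsingleton.finite fun x hx y hy =>
          hinj i v hi h (Eq.trans hx (Eq.symm hy))
      obtain ⟨x, hx⟩ := hfin.exists_notMem
      refine ⟨Function.update h v x, fun i hi => ?_⟩
      by_cases hvi : v ∈ supp i
      · exact fun h1 => hx (Set.mem_biUnion (show i ∈ {i | v ∈ supp i} from hvi) h1)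
      · rw [hindep i v hvi]
        refine hh i ?_
        rw [Finset.coe_insert] at hi
        exact (Set.subset_insert_iff_of_notMem hvi).1 hi
  have := Fintype.ofFinite X
  obtain ⟨h, hh⟩ := key Finset.univ
  exact ⟨h, fun i => hh i (by simp)⟩

section DartCycle

variable {V α : Type*} {G : SimpleGraph V} {n : ℕ}

/-- A cycle of length `n` in the graph obtained from `G` by identifying vertices according to `c`,
given by the darts of `G` that it traverses. Loops and pairs of parallel edges are cycles of length
one and two. -/
structure IsDartCycle (c : V → α) (d : ZMod n → G.Dart) : Prop where
  link : ∀ i, c (d i).snd = c (d (i + 1)).fst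
  fst_injective : Function.Injective fun i => c (d i).fst
  edge_injective : Function.Injective fun i => (d i).edge

/-- The set of edges of a cyclic sequence of darts. -/
def dartEdges (d : ZMod n → G.Dart) : Set (Sym2 V) := Set.range fun i => (d i).edge

/-- The cyclic sequence of darts `d` remains a closed walk when vertices are identified according
to `q`. -/
def IsClosedVia {β : Type*} (q : V → β) (d : ZMod n → G.Dart) : Prop :=
  ∀ i, q (d i).snd = q (d (i + 1)).fst

namespace IsDartCycle

variable {c : V → α} {d : ZMod n → G.Dart}

lemma shift (hd : IsDartCycle c d) (k : ZMod n) : IsDartCycle c fun i => d (i + k) where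
  link i := by rw [hd.link, add_right_comm]
  fst_injective := hd.fst_injective.comp (add_left_injective k)
  edge_injective := hd.edge_injective.comp (add_left_injective k)

lemma _root_.dartEdges_shift (d : ZMod n → G.Dart) (k : ZMod n) :
    dartEdges (fun i => d (i + k)) = dartEdges d :=
  (Equiv.addRight k).surjective.range_comp fun i => (d i).edge

lemma injective (hd : IsDartCycle c d) : Function.Injective d :=
  .of_comp (f := SimpleGraph.Dart.edge) hd.edge_injective

lemma ncard_dartEdges (hd : IsDartCycle c d) : (dartEdges d).ncard = n := by
  rw [dartEdges, Set.ncard_range_of_injective hd.edge_injective, Nat.card_zmod]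

end IsDartCycle

section GapWord

variable {c : V → α} {β Γ : Type*} [Group Γ] {q : V → β} {d : ZMod n → G.Dart}

/-- The value, up to conjugation, of the cyclic sequence of darts `d` in the labelling
`(h (q u))⁻¹ * g * h (q v)` of the darts `uv`. -/
def gapWord (q : V → β) (g : G.Dart → Γ) (d : ZMod n → G.Dart) (h : β → Γ) : Γ :=
  cyclicProd fun i => g (d i) * (h (q (d i).snd) * (h (q (d (i + 1)).fst))⁻¹)

/-- The ends of the gaps that are left in the cyclic sequence of darts `d` when vertices are only
identified according to `q`. -/
def gapEnds (q : V → β) (d : ZMod n → G.Dart) : Set β :=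
  {v | ∃ i, q (d i).snd ≠ q (d (i + 1)).fst ∧ (v = q (d i).snd ∨ v = q (d (i + 1)).fst)}

lemma gapEnds_nonempty (hd : ¬ IsClosedVia q d) : (gapEnds q d).Nonempty := by
  obtain ⟨i, hi⟩ := not_forall.1 hd
  exact ⟨_, i, hi, Or.inl rfl⟩

lemma gapWord_eq_cyclicProd (hd : IsClosedVia q d) (g : G.Dart → Γ) (h : β → Γ) :
    gapWord q g d h = cyclicProd fun i => g (d i) := by
  simp only [gapWord, hd _, mul_inv_cancel, mul_one]

lemma cyclicProd_gauge_eq_one_iff (q : V → β) (g : G.Dart → Γ) (d : ZMod n → G.Dart) (h : β → Γ) :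
    cyclicProd (fun i => (h (q (d i).fst))⁻¹ * g (d i) * h (q (d i).snd)) = 1 ↔
      gapWord q g d h = 1 := by
  rw [cyclicProd_regroup (fun i => h (q (d i).fst)) (fun i => h (q (d i).snd))]
  simpa [gapWord] using conj_eq_one_iff (a := (h (q (d 0).fst))⁻¹) (b := gapWord q g d h)

lemma gapWord_update_of_notMem [DecidableEq β] {v : β} (hv : v ∉ gapEnds q d) (g : G.Dart → Γ)
    (h : β → Γ) (x : Γ) : gapWord q g d (Function.update h v x) = gapWord q g d h := by
  refine congrArg cyclicProd (funext fun i => ?_)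
  by_cases hi : q (d i).snd = q (d (i + 1)).fst
  · simp only [hi, mul_inv_cancel]
  · have hsnd : q (d i).snd ≠ v := fun he => hv ⟨i, hi, Or.inl he.symm⟩
    have hfst : q (d (i + 1)).fst ≠ v := fun he => hv ⟨i, hi, Or.inr he.symm⟩
    rw [Function.update_of_ne hsnd, Function.update_of_ne hfst]

/-- The gaps of a cycle lie over different vertices of the cycle, so each end of a gap occurs in
a single factor of the word. -/
lemma IsDartCycle.gapWord_update_injective [NeZero n] [DecidableEq β] (hd : IsDartCycle c d)
    (hq : ∀ a b, q a = q b → c a = c b) {v : β} (hv : v ∈ gapEnds q d) (g : G.Dart → Γ)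
    (h : β → Γ) : Function.Injective fun x => gapWord q g d (Function.update h v x) := by
  intro x y hxy
  obtain ⟨j, hj, hvj⟩ := hv
  have hlies : ∀ k, (v = q (d k).snd ∨ v = q (d (k + 1)).fst) →
      ∃ a, q a = v ∧ c a = c (d (k + 1)).fst := by
    rintro k (hk | hk)
    · exact ⟨_, hk.symm, hd.link k⟩
    · exact ⟨_, hk.symm, rfl⟩
  have hother : ∀ k, k ≠ j → q (d k).snd ≠ v ∧ q (d (k + 1)).fst ≠ v := by
    intro k hkj
    by_contra hcon
    obtain ⟨a, hav, ha⟩ := hlies k (by grind)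
    obtain ⟨b, hbv, hb⟩ := hlies j hvj
    have hab : c (d (k + 1)).fst = c (d (j + 1)).fst := by
      rw [← ha, ← hb, hq a b (hav.trans hbv.symm)]
    exact hkj (add_right_cancel (hd.fst_injective hab))
  have hfactor := eq_of_cyclicProd_eq (j := j) (fun k hk => by
    simp only [Function.update_of_ne (hother k hk).1, Function.update_of_ne (hother k hk).2]) hxy
  replace hfactor := mul_left_cancel hfactor
  rcases hvj with rfl | rfl
  · simpa [Function.update_of_ne hj.symm] using hfactor
  · simpa [Function.update_of_ne hj] using hfactor

lemma exists_generic_potential [Finite G.Dart] [Finite β] [Infinite Γ]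
    (hq : ∀ a b, q a = q b → c a = c b) (g : G.Dart → Γ) :
    ∃ h : β → Γ, ∀ (n : ℕ) [NeZero n] (d : ZMod n → G.Dart), IsDartCycle c d →
      (cyclicProd (fun i => (h (q (d i).fst))⁻¹ * g (d i) * h (q (d i).snd)) = 1 ↔
        IsClosedVia q d ∧ cyclicProd (fun i => g (d i)) = 1) := by
  classical
  let ι := {x : Σ m : Fin (Nat.card G.Dart), ZMod (m + 1) → G.Dart //
    IsDartCycle c x.2 ∧ ¬ IsClosedVia q x.2}
  obtain ⟨h, hh⟩ : ∃ h : β → Γ, ∀ x : ι, gapWord q g x.1.2 h ≠ 1 :=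
    exists_forall_word_ne _ _ (fun x : ι => gapEnds q x.1.2) (fun x => gapEnds_nonempty x.2.2)
      (fun _ _ hv => gapWord_update_of_notMem hv g)
      fun x _ hv => x.2.1.gapWord_update_injective hq hv g
  refine ⟨h, fun n _ d hd => ?_⟩
  rw [cyclicProd_gauge_eq_one_iff]
  by_cases hclosed : IsClosedVia q d
  · simp only [gapWord_eq_cyclicProd hclosed, hclosed, true_and]
  · obtain ⟨m, rfl⟩ := Nat.exists_eq_succ_of_ne_zero (NeZero.ne n)
    have hm : m < Nat.card G.Dart := by
      have := Nat.card_le_card_of_injective d hd.injective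
      rwa [Nat.card_zmod] at this
    simp only [hclosed, false_and, iff_false]
    exact hh ⟨⟨⟨m, hm⟩, d⟩, hd, hclosed⟩

end GapWord

end DartCycle

/-! ### Identification of vertices -/

section Identification

variable {V α : Type*} {G : SimpleGraph V} {K : Graph α (Sym2 V)} {c : V → α} {X : Set (Sym2 V)}

/-- `K` is obtained from `G` by deleting the edges in `X` and identifying vertices according
to `c`. -/
def IsIdentification (K : Graph α (Sym2 V)) (G : SimpleGraph V) (c : V → α) (X : Set (Sym2 V)) :
    Prop :=
  ∀ f a b, K.IsLink f a b ↔ f ∉ X ∧ ∃ d : G.Dart, d.edge = f ∧ c d.fst = a ∧ c d.snd = b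

lemma isIdentification_ofSimpleGraph_map (c : V → α) :
    IsIdentification ((Graph.ofSimpleGraph G).map c) G c ∅ := by
  intro f a b
  simp only [Graph.map_isLink, Set.mem_empty_iff_false, not_false_eq_true, true_and,
    Relation.Map, Graph.ofSimpleGraph]
  constructor
  · rintro ⟨u, v, ⟨rfl, h⟩, rfl, rfl⟩
    exact ⟨⟨(u, v), h⟩, rfl, rfl, rfl⟩
  · rintro ⟨d, rfl, rfl, rfl⟩
    exact ⟨d.fst, d.snd, ⟨rfl, d.edge_mem⟩, rfl, rfl⟩

namespace IsIdentification

lemma deleteEdges (hK : IsIdentification K G c X) (Y : Set (Sym2 V)) :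
    IsIdentification (K.deleteEdges Y) G c (X ∪ Y) := by
  intro f a b
  rw [Graph.deleteEdges_isLink, hK, Set.mem_union]
  tauto

lemma map {α' : Type*} (hK : IsIdentification K G c X) (m : α → α') :
    IsIdentification (K.map m) G (m ∘ c) X := by
  intro f a b
  simp only [Graph.map_isLink, Relation.Map, hK f]
  constructor
  · rintro ⟨u, v, ⟨h, d, rfl, rfl, rfl⟩, rfl, rfl⟩
    exact ⟨h, d, rfl, rfl, rfl⟩
  · rintro ⟨h, d, rfl, rfl, rfl⟩
    exact ⟨_, _, ⟨h, d, rfl, rfl, rfl⟩, rfl, rfl⟩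

lemma notMem_of_mem_edges (hK : IsIdentification K G c X) {u v : α} (p : K.Walk u v) {e : Sym2 V}
    (he : e ∈ p.edges) : e ∉ X := by
  induction p with
  | nil => simp [Graph.Walk.edges] at he
  | cons f h p ih =>
    rcases List.mem_cons.1 he with rfl | he
    · exact ((hK _ _ _).1 h).1
    · exact ih he

end IsIdentification

lemma exists_walk_of_isLink {β : Type*} {K : Graph α β} {v : ℕ → α} {e : ℕ → β}
    (h : ∀ j, K.IsLink (e j) (v j) (v (j + 1))) (k : ℕ) {w : α} (hw : v k = w) :
    ∃ p : K.Walk (v 0) w,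
      p.edges = (List.range k).map e ∧ p.support = (List.range (k + 1)).map v := by
  induction k generalizing v e with
  | zero =>
    subst hw
    exact ⟨.nil (h 0).left_mem, rfl, rfl⟩
  | succ k ih =>
    obtain ⟨p, hedges, hsupport⟩ := ih (v := fun j => v (j + 1)) (fun j => h (j + 1)) hw
    refine ⟨.cons _ (h 0) p, ?_, ?_⟩
    · simp [Graph.Walk.edges, hedges, List.range_succ_eq_map, Function.comp_def]
    · rw [Graph.Walk.support, hsupport, List.range_succ_eq_map (n := k + 1)]
      simp [Function.comp_def]

lemma natCast_zmod_injOn (n : ℕ) : Set.InjOn (Nat.cast : ℕ → ZMod n) (Set.Iio n) :=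
  fun i hi j hj hij => by
    rw [← ZMod.val_natCast_of_lt hi, hij, ZMod.val_natCast_of_lt hj]

lemma nodup_map_range {β : Type*} {n : ℕ} {f : ZMod n → β} (hf : Function.Injective f) :
    ((List.range n).map fun i : ℕ => f i).Nodup :=
  List.nodup_range.map_on fun _ hi _ hj hij =>
    natCast_zmod_injOn n (List.mem_range.1 hi) (List.mem_range.1 hj) (hf hij)

lemma dartEdges_eq_image {n : ℕ} [NeZero n] (d : ZMod n → G.Dart) :
    dartEdges d = (fun i : ℕ => (d i).edge) '' Set.Iio n := by
  ext e
  constructor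
  · rintro ⟨i, rfl⟩
    exact ⟨i.val, i.val_lt, by simp⟩
  · rintro ⟨i, -, rfl⟩
    exact ⟨i, rfl⟩

lemma IsDartCycle.isCycleSet {n : ℕ} [NeZero n] {d : ZMod n → G.Dart} (hd : IsDartCycle c d)
    (hK : IsIdentification K G c X) (hX : ∀ i, (d i).edge ∉ X) : K.IsCycleSet (dartEdges d) := by
  have hlink : ∀ j : ℕ, K.IsLink (d j).edge (c (d j).fst) (c (d ↑(j + 1)).fst) := fun j =>
    (hK _ _ _).2 ⟨hX j, d j, rfl, rfl, by rw [hd.link j, Nat.cast_add_one]⟩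
  obtain ⟨p, hedges, hsupport⟩ := exists_walk_of_isLink (v := fun j : ℕ => c (d j).fst) hlink n
    (w := c (d (0 : ℕ)).fst) (by simp)
  refine ⟨_, p, ⟨by simpa [hedges] using NeZero.ne n, ?_, ?_⟩, ?_⟩
  · rw [hedges]
    exact nodup_map_range hd.edge_injective
  · rw [hsupport, List.range_succ_eq_map, List.map_cons, List.tail_cons, List.map_map]
    simpa [Function.comp_def] using
      nodup_map_range (hd.fst_injective.comp (add_left_injective 1))
  · ext e
    simp [dartEdges_eq_image, Graph.Walk.edgeSet, hedges]

open Classical in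
/-- The factor that a group labelling contributes to the value of a walk traversing the edge `e`
from its end `u`. -/
noncomputable def stepGain {β Γ : Type*} [Group Γ] {K : Graph α β} (φ : K.GroupLabelling Γ) (u : α)
    (e : E(K)) : Γ :=
  if u = φ.tail e then φ.label e else (φ.label e)⁻¹

/-- Every traversal of an edge of `K` comes from a dart of `G` at which `ℓ` takes the value that
`φ` gives to this traversal. -/
def LiftsGain {Γ : Type*} [Group Γ] (c : V → α) (φ : K.GroupLabelling Γ) (ℓ : G.Dart → Γ) : Prop :=
  ∀ ⦃e u v⦄ (h : K.IsLink e u v),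
    ∃ d : G.Dart, d.edge = e ∧ c d.fst = u ∧ c d.snd = v ∧ ℓ d = stepGain φ u ⟨e, h.edge_mem⟩

lemma IsIdentification.exists_liftsGain (hK : IsIdentification K G c X) {Γ : Type*} [Group Γ]
    {ℓ : G.Dart → Γ} (hℓ : ∀ d, ℓ d.symm = (ℓ d)⁻¹) :
    ∃ φ : K.GroupLabelling Γ, LiftsGain c φ ℓ := by
  have hdart : ∀ e : E(K), ∃ d : G.Dart, d.edge = e ∧ K.IsLink e (c d.fst) (c d.snd) := by
    rintro ⟨e, he⟩
    obtain ⟨x, y, hxy⟩ := K.exists_isLink_of_mem_edgeSet he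
    obtain ⟨-, d, hd, rfl, rfl⟩ := (hK _ _ _).1 hxy
    exact ⟨d, hd, hxy⟩
  choose D hDe hDl using hdart
  refine ⟨⟨fun e => c (D e).fst, fun e => ⟨_, hDl e⟩, fun e => ℓ (D e)⟩, fun e u v h => ?_⟩
  have he := hDe ⟨e, h.edge_mem⟩
  simp only [stepGain]
  rcases (hDl ⟨e, h.edge_mem⟩).eq_and_eq_or_eq_and_eq h with ⟨hu, hv⟩ | ⟨hv, hu⟩
  · exact ⟨_, he, hu, hv, by rw [if_pos hu.symm]⟩
  · by_cases hloop : u = c (D ⟨e, h.edge_mem⟩).fst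
    · exact ⟨_, he, hloop.symm, hu.trans (hloop.trans hv), by rw [if_pos hloop]⟩
    · exact ⟨(D ⟨e, h.edge_mem⟩).symm, by simpa using he, hu, hv, by rw [if_neg hloop, hℓ]⟩

lemma LiftsGain.exists_darts {Γ : Type*} [Group Γ] {φ : K.GroupLabelling Γ} {ℓ : G.Dart → Γ}
    (hφ : LiftsGain c φ ℓ) {u v : α} (p : K.Walk u v) :
    ∃ L : List G.Dart, L.map SimpleGraph.Dart.edge = p.edges ∧
      L.map (fun d => c d.fst) ++ [v] = p.support ∧ u :: L.map (fun d => c d.snd) = p.support ∧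
      (L.map ℓ).prod = p.gain φ := by
  induction p with
  | nil => exact ⟨[], by simp [Graph.Walk.edges, Graph.Walk.support, Graph.Walk.gain]⟩
  | cons e h p ih =>
    obtain ⟨L, hedges, hfst, hsnd, hprod⟩ := ih
    obtain ⟨d, rfl, rfl, rfl, hd⟩ := hφ h
    exact ⟨d :: L, by simp [Graph.Walk.edges, hedges], by simp [Graph.Walk.support, ← hfst],
      by simp [Graph.Walk.support, ← hsnd], by rw [List.map_cons, List.prod_cons, hprod, hd]; rfl⟩

lemma isDartCycle_of_list {L : List G.Dart} [NeZero L.length]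
    (hedge : (L.map SimpleGraph.Dart.edge).Nodup) (hsnd : (L.map fun d => c d.snd).Nodup)
    (hlink : L.map (fun d => c d.snd) = (L.map fun d => c d.fst).rotate 1) :
    IsDartCycle c fun i : ZMod L.length => L[i.val]'i.val_lt where
  link i := by
    have hi := i.val_lt
    have hsucc : (i + 1).val = (i.val + 1) % L.length := by
      rw [ZMod.val_add, ZMod.val_one_eq_one_mod, Nat.add_mod_mod]
    calc c L[i.val].snd = (L.map fun d => c d.snd)[i.val]'(by simpa) := by simp
      _ = ((L.map fun d => c d.fst).rotate 1)[i.val]'(by simpa) := by simp only [hlink]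
      _ = c (L[(i + 1).val]'(i + 1).val_lt).fst := by simp [List.getElem_rotate, hsucc]
  fst_injective i j hij := by
    have hfst : (L.map fun d => c d.fst).Nodup := List.nodup_rotate.1 (hlink ▸ hsnd)
    exact ZMod.val_injective _ ((hfst.getElem_inj_iff (hi := by simpa using i.val_lt)
      (hj := by simpa using j.val_lt)).1 (by simpa using hij))
  edge_injective i j hij :=
    ZMod.val_injective _ ((hedge.getElem_inj_iff (hi := by simpa using i.val_lt)
      (hj := by simpa using j.val_lt)).1 (by simpa using hij))

lemma LiftsGain.exists_isDartCycle {Γ : Type*} [Group Γ] {φ : K.GroupLabelling Γ}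
    {ℓ : G.Dart → Γ} (hφ : LiftsGain c φ ℓ) {u : α} {p : K.Walk u u} (hp : p.IsCycle) :
    ∃ (n : ℕ) (_ : NeZero n) (d : ZMod n → G.Dart), IsDartCycle c d ∧ dartEdges d = p.edgeSet ∧
      cyclicProd (fun i => ℓ (d i)) = p.gain φ := by
  obtain ⟨L, hedges, hfst, hsnd, hprod⟩ := hφ.exists_darts p
  have hL : L ≠ [] := by
    rintro rfl
    exact hp.ne_nil hedges.symm
  have : NeZero L.length := ⟨by simpa using hL⟩
  have hlink : L.map (fun d => c d.snd) = (L.map fun d => c d.fst).rotate 1 := by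
    obtain ⟨d, L, rfl⟩ := List.exists_cons_of_ne_nil hL
    obtain ⟨h₁, h₂⟩ := List.cons_eq_cons.1 (hfst.trans hsnd.symm)
    rw [← h₂, ← h₁]
    simp
  refine ⟨_, this, _, isDartCycle_of_list (hedges ▸ hp.edges_nodup) ?_ hlink, ?_, ?_⟩
  · simpa [← hsnd] using hp.support_tail_nodup
  · ext e
    rw [Graph.Walk.edgeSet, ← hedges]
    constructor
    · rintro ⟨i, rfl⟩
      exact List.mem_map_of_mem (List.getElem_mem _)
    · intro he
      obtain ⟨d, hd, rfl⟩ := List.mem_map.1 he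
      obtain ⟨i, hi, rfl⟩ := List.mem_iff_getElem.1 hd
      exact ⟨i, by simp [Nat.mod_eq_of_lt hi]⟩
  · rw [← hprod, cyclicProd]
    congr 1
    refine List.ext_getElem (by simp) fun i hi _ => ?_
    simp only [List.length_map, List.length_range] at hi
    simp [Nat.mod_eq_of_lt hi]

/-- A labelling of the darts realises `𝓑` if it does so on the cycles given by darts. -/
lemma IsIdentification.labellable_of_cyclicProd (hK : IsIdentification K G c X) {Γ : Type*}
    [Group Γ] {ℓ : G.Dart → Γ} (hℓ : ∀ d, ℓ d.symm = (ℓ d)⁻¹) {𝓑 : Set (Set (Sym2 V))}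
    (h𝓑 : ∀ C ∈ 𝓑, K.IsCycleSet C)
    (h : ∀ (n : ℕ) [NeZero n] (d : ZMod n → G.Dart), IsDartCycle c d → (∀ i, (d i).edge ∉ X) →
      (cyclicProd (fun i => ℓ (d i)) = 1 ↔ dartEdges d ∈ 𝓑)) :
    K.Labellable 𝓑 Γ := by
  obtain ⟨φ, hφ⟩ := hK.exists_liftsGain hℓ
  have hgain : ∀ {u : α} {p : K.Walk u u}, p.IsCycle → (p.gain φ = 1 ↔ p.edgeSet ∈ 𝓑) := by
    intro u p hp
    obtain ⟨n, _, d, hd, hedges, hprod⟩ := hφ.exists_isDartCycle hp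
    rw [← hprod, ← hedges]
    exact h n d hd fun i => hK.notMem_of_mem_edges p (hedges.subset ⟨i, rfl⟩)
  refine ⟨φ, Set.ext fun C => ⟨?_, fun hC => ?_⟩⟩
  · rintro ⟨u, p, hp, rfl, hp1⟩
    exact (hgain hp).1 hp1
  · obtain ⟨u, p, hp, rfl⟩ := h𝓑 C hC
    exact ⟨u, p, hp, rfl, (hgain hp).2 hC⟩

/-- Two kinds of unbalanced cycles are told apart from the balanced ones: those that `q` leaves open
have nontrivial value for a generic choice of potentials, the others for their winding number
`∑ i, ψ (d i)`. -/
lemma IsIdentification.labellable_of_winding (hK : IsIdentification K G c X) [Finite G.Dart]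
    {β : Type*} [Finite β] {q : V → β} (hq : ∀ a b, q a = q b → c a = c b) {ψ : G.Dart → ℤ}
    (hψ : ∀ d, ψ d.symm = -ψ d) {𝓑 : Set (Set (Sym2 V))} (h𝓑 : ∀ C ∈ 𝓑, K.IsCycleSet C)
    (hwind : ∀ (n : ℕ) [NeZero n] (d : ZMod n → G.Dart), IsDartCycle c d →
      (∀ i, (d i).edge ∉ X) → IsClosedVia q d → |∑ i, ψ (d i)| ≤ 1)
    (hmem : ∀ (n : ℕ) [NeZero n] (d : ZMod n → G.Dart), IsDartCycle c d →
      (∀ i, (d i).edge ∉ X) → (dartEdges d ∈ 𝓑 ↔ IsClosedVia q d ∧ ∑ i, ψ (d i) = 0))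
    (Γ : Type*) [Group Γ] [Infinite Γ] : K.Labellable 𝓑 Γ := by
  obtain ⟨γ, hγ⟩ := exists_ne (1 : Γ)
  have hpow : ∀ s : ℤ, |s| ≤ 1 → (γ ^ s = 1 ↔ s = 0) := by
    intro s hs
    obtain rfl | rfl | rfl : s = -1 ∨ s = 0 ∨ s = 1 := by rw [abs_le] at hs; omega
    all_goals simp [hγ]
  obtain ⟨h, hh⟩ := exists_generic_potential (Γ := Γ) hq fun d : G.Dart => γ ^ ψ d
  refine hK.labellable_of_cyclicProd (ℓ := fun d => (h (q d.fst))⁻¹ * γ ^ ψ d * h (q d.snd))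
    (fun d => by simp [hψ, mul_assoc]) h𝓑 fun n _ d hd hX => ?_
  rw [hh n d hd, hmem n d hd hX, cyclicProd_zpow]
  exact and_congr_right fun hclosed => hpow _ (hwind n d hd hX hclosed)

end Identification

/-! ### Faces of a rainbow colouring -/

section Faces

variable {V : Type*} {G : SimpleGraph V}

lemma mem_of_dart_closed (hG : G.Connected) {S : Set V} {v : V} (hv : v ∈ S)
    (h : ∀ d : G.Dart, d.fst ∈ S → d.snd ∈ S) (w : V) : w ∈ S := by
  obtain ⟨p⟩ := hG.preconnected v w
  induction p with
  | nil => exact hv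
  | cons hadj _ ih => exact ih (h ⟨(_, _), hadj⟩ hv)

instance [Finite V] : Finite G.Dart :=
  Finite.of_injective _ (SimpleGraph.Dart.toProd_injective (G := G))

namespace RotationSystem

variable (R : RotationSystem G)

lemma facePerm_symm (d : G.Dart) : R.facePerm d.symm = R.next d := by
  simp [facePerm]

lemma facePerm_eq (d : G.Dart) : R.facePerm d = R.next d.symm := rfl

@[simp] lemma facePerm_fst (d : G.Dart) : (R.facePerm d).fst = d.snd := by
  rw [facePerm_eq, R.fst_next]; rfl

lemma face_eq_iff {d d' : G.Dart} : R.face d = R.face d' ↔ R.facePerm.SameCycle d d' :=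
  Quotient.eq (r := Equiv.Perm.SameCycle.setoid R.facePerm)

@[simp] lemma face_facePerm (d : G.Dart) : R.face (R.facePerm d) = R.face d :=
  R.face_eq_iff.2 (Equiv.Perm.sameCycle_apply_left.2 (.refl _ _))

lemma face_next (d : G.Dart) : R.face (R.next d) = R.face d.symm := by
  rw [← facePerm_symm, face_facePerm]

lemma exists_face_eq (f : R.Face) : ∃ d, R.face d = f := Quotient.exists_rep f

lemma mem_boundary_iff {d : G.Dart} {f : R.Face} :
    d.edge ∈ R.boundary f ↔ R.face d = f ∨ R.face d.symm = f := by
  constructor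
  · rintro ⟨a, ha, hd⟩
    rcases (SimpleGraph.dart_edge_eq_iff _ _).1 hd with rfl | rfl
    · exact Or.inl ha
    · exact Or.inr ha
  · rintro (h | h)
    · exact ⟨d, h, rfl⟩
    · exact ⟨d.symm, h, d.edge_symm⟩

lemma exists_face_snd_fst {f : R.Face} {v : V} {g : Sym2 V}
    (hg : g ∈ R.boundary f) (hv : v ∈ g) :
    ∃ a b : G.Dart, R.face a = f ∧ R.face b = f ∧ a.snd = v ∧ b.fst = v := by
  obtain ⟨d, rfl, rfl⟩ := hg
  rcases Sym2.mem_iff.1 hv with rfl | rfl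
  · refine ⟨R.facePerm.symm d, d, ?_, rfl, ?_, rfl⟩
    · rw [← R.face_facePerm, Equiv.apply_symm_apply]
    · rw [← R.facePerm_fst, Equiv.apply_symm_apply]
  · exact ⟨d, R.facePerm d, rfl, R.face_facePerm d, rfl, R.facePerm_fst d⟩

instance [Finite V] : Finite R.Face := inferInstanceAs (Finite (Quotient _))

lemma exists_cyclic_enumeration [Finite V] (f : R.Face) :
    ∃ (n : ℕ) (_ : NeZero n) (d : ZMod n → G.Dart), Function.Injective d ∧
      Set.range d = {a | R.face a = f} ∧ ∀ i, d (i + 1) = R.facePerm (d i) := by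
  obtain ⟨a, rfl⟩ := R.exists_face_eq f
  let e := MulAction.orbitZPowersEquiv R.facePerm a
  have he (k : ℤ) : (e.symm k : G.Dart) = (R.facePerm ^ k) a := by
    simp only [e, MulAction.orbitZPowersEquiv_symm_apply']
    rfl
  have hper : a ∈ Function.periodicPts (R.facePerm • ·) :=
    R.facePerm.injective.mem_periodicPts a
  refine ⟨_, ⟨(Function.minimalPeriod_pos_of_mem_periodicPts hper).ne'⟩, fun i => e.symm i,
    Subtype.val_injective.comp e.symm.injective, ?_, fun i => ?_⟩
  · ext b
    simp only [Set.mem_range, Set.mem_ofPred_eq, R.face_eq_iff]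
    constructor
    · rintro ⟨i, rfl⟩
      obtain ⟨k, rfl⟩ := ZMod.intCast_surjective i
      exact he k ▸ Equiv.Perm.sameCycle_zpow_left.2 (.refl _ _)
    · rintro h
      obtain ⟨k, rfl⟩ := h.symm
      exact ⟨k, he k⟩
  · obtain ⟨k, rfl⟩ := ZMod.intCast_surjective i
    have := he (k + 1)
    rw [Int.cast_add, Int.cast_one] at this
    simp only [this, he, add_comm k, zpow_one_add, Equiv.Perm.mul_apply]

lemma next_induction [Finite V] {p : G.Dart → Prop} {d : G.Dart} (hd : p d)
    (h : ∀ x, p x → p (R.next x)) {x : G.Dart} (hx : x.fst = d.fst) : p x := by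
  obtain ⟨i, rfl⟩ := (R.sameCycle d x hx.symm).exists_nat_pow_eq
  clear hx
  induction i with
  | zero => exact hd
  | succ i ih => rw [pow_succ', Equiv.Perm.mul_apply]; exact h _ ih

lemma face_mem_of_closed [Finite V] (hG : G.Connected) {X : Set R.Face} {f : R.Face} (hf : f ∈ X)
    (h : ∀ d, R.face d ∈ X → R.face d.symm ∈ X) (f' : R.Face) : f' ∈ X := by
  obtain ⟨d, rfl⟩ := R.exists_face_eq f
  obtain ⟨d', rfl⟩ := R.exists_face_eq f'
  have hat (d x : G.Dart) (hd : R.face d ∈ X) (hx : x.fst = d.fst) : R.face x ∈ X :=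
    R.next_induction (p := fun x => R.face x ∈ X) hd
      (fun y hy => by rw [R.face_next]; exact h y hy) hx
  exact mem_of_dart_closed hG (S := {v | ∀ x : G.Dart, x.fst = v → R.face x ∈ X}) (v := d.fst)
    (fun x hx => hat d x hf hx) (fun y hy x hx => hat y.symm x (h y (hy y rfl)) hx) d'.fst d' rfl

end RotationSystem

end Faces

section Rainbow

variable {V : Type*} {G : SimpleGraph V}

/-- The hypotheses under which the argument works: the graph is connected, is not a cycle (it has a
vertex of degree at least three), and every colour appears exactly once on every face. -/
structure RotationSystem.IsRainbow (R : RotationSystem G) {t : ℕ} (col : V → Fin t) : Prop where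
  connected : G.Connected
  two_lt_degree : ∃ v, 2 < (G.neighborSet v).encard
  existsUnique : ∀ (f : R.Face) (c : Fin t), ∃! d : G.Dart, R.face d = f ∧ col d.fst = c

lemma encard_neighborSet_le_two {v : V} {a b : G.Dart}
    (h : ∀ x : G.Dart, x.fst = v → x = a ∨ x = b) : (G.neighborSet v).encard ≤ 2 := by
  have hsub : G.neighborSet v ⊆ {a.snd, b.snd} := fun w hw => by
    rcases h ⟨(v, w), hw⟩ rfl with rfl | rfl <;> simp
  calc (G.neighborSet v).encard ≤ ({a.snd, b.snd} : Set V).encard := Set.encard_le_encard hsub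
    _ ≤ ({b.snd} : Set V).encard + 1 := Set.encard_insert_le _ _
    _ = 2 := by rw [Set.encard_singleton, one_add_one_eq_two]

namespace RotationSystem.IsRainbow

variable {R : RotationSystem G} {t : ℕ} {col : V → Fin t}

lemma eq_of_fst (h : R.IsRainbow col) {a b : G.Dart} (hf : R.face a = R.face b)
    (hc : col a.fst = col b.fst) : a = b :=
  (h.existsUnique (R.face b) (col b.fst)).unique ⟨hf, hc⟩ ⟨rfl, rfl⟩

lemma facePerm_eq_of_link (h : R.IsRainbow col) {a b : G.Dart} (hf : R.face a = R.face b)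
    (hc : col a.snd = col b.fst) : R.facePerm a = b :=
  h.eq_of_fst (by simpa using hf) (by simpa using hc)

lemma eq_of_snd (h : R.IsRainbow col) {a b : G.Dart} (hf : R.face a = R.face b)
    (hc : col a.snd = col b.snd) : a = b :=
  R.facePerm.injective (h.eq_of_fst (by simpa using hf) (by simpa using hc))

lemma col_fst_ne (h : R.IsRainbow col) (d : G.Dart) : col d.fst ≠ col d.snd := by
  intro hd
  have h1 := R.facePerm_fst d
  rw [h.facePerm_eq_of_link rfl hd.symm] at h1
  exact d.adj.ne h1

lemma false_of_degree_le_two (h : R.IsRainbow col) {S : Set V} {v : V} (hv : v ∈ S)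
    (hS : ∀ d : G.Dart, d.fst ∈ S → d.snd ∈ S)
    (hdeg : ∀ v ∈ S, ∃ a b : G.Dart, ∀ x : G.Dart, x.fst = v → x = a ∨ x = b) : False := by
  obtain ⟨w, hw⟩ := h.two_lt_degree
  obtain ⟨a, b, hab⟩ := hdeg w (mem_of_dart_closed h.connected hv hS w)
  exact hw.not_ge (encard_neighborSet_le_two hab)

/-- If both sides of an edge were the same face, both its ends would have degree one. -/
lemma face_symm_ne [Finite V] (h : R.IsRainbow col) (d : G.Dart) : R.face d.symm ≠ R.face d := by
  intro hd
  have eq_of_next {d : G.Dart} (hd : R.next d = d) (x : G.Dart) (hx : x.fst = d.fst) : x = d :=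
    R.next_induction (p := (· = d)) rfl (by rintro _ rfl; exact hd) hx
  have h1 : R.next d = d := by
    rw [← R.facePerm_symm]
    exact h.facePerm_eq_of_link hd rfl
  have h2 : R.next d.symm = d.symm := by
    rw [← R.facePerm_eq]
    exact h.facePerm_eq_of_link hd.symm rfl
  refine h.false_of_degree_le_two (S := {d.fst, d.snd}) (v := d.fst) (by simp) ?_ ?_
  · rintro x (hx | hx)
    · rw [eq_of_next h1 x hx]; simp
    · rw [eq_of_next h2 x hx]; simp
  · rintro v (rfl | rfl)
    · exact ⟨d, d, fun x hx => Or.inl (eq_of_next h1 x hx)⟩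
    · exact ⟨d.symm, d.symm, fun x hx => Or.inl (eq_of_next h2 x hx)⟩

lemma eq_of_edge_eq [Finite V] (h : R.IsRainbow col) {a b : G.Dart} (hf : R.face a = R.face b)
    (he : a.edge = b.edge) : a = b := by
  rcases (SimpleGraph.dart_edge_eq_iff _ _).1 he with rfl | rfl
  · rfl
  · exact absurd hf (h.face_symm_ne b)

/-- If every edge of a face `f` had `f'` on its other side, every vertex of `f` would have degree
two. -/
lemma exists_face_symm_ne [Finite V] (h : R.IsRainbow col) {f f' : R.Face}
    (hop' : ∀ d, R.face d = f' → R.face d.symm = f) :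
    ∃ d, R.face d = f ∧ R.face d.symm ≠ f' := by
  by_contra! hop
  have next_next (d) (hd : R.face d = f) : R.next (R.next d) = d := by
    refine h.eq_of_fst ?_ (by rw [R.fst_next, R.fst_next])
    rw [R.face_next, hop' _ (by rw [R.face_next, hop d hd]), hd]
  have eq_or_eq (d) (hd : R.face d = f) (x : G.Dart) (hx : x.fst = d.fst) :
      x = d ∨ x = R.next d := by
    refine R.next_induction (p := fun x => x = d ∨ x = R.next d) (Or.inl rfl) ?_ hx
    rintro y (rfl | rfl)
    · exact Or.inr rfl
    · exact Or.inl (next_next d hd)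
  obtain ⟨d₀, hd₀⟩ := R.exists_face_eq f
  refine h.false_of_degree_le_two (S := {v | ∃ d, R.face d = f ∧ d.fst = v})
    ⟨d₀, hd₀, rfl⟩ ?_ ?_
  · rintro x ⟨d, hd, hx⟩
    rcases eq_or_eq d hd x hx.symm with rfl | rfl
    · exact ⟨R.facePerm x, by simpa using hd, by simp⟩
    · exact ⟨(R.next d).symm, hop' _ (by rw [R.face_next, hop d hd]), rfl⟩
  · rintro v ⟨d, hd, rfl⟩
    exact ⟨d, R.next d, eq_or_eq d hd⟩

lemma boundary_injective [Finite V] (h : R.IsRainbow col) : Function.Injective R.boundary := by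
  intro f f' hff'
  by_contra hne
  have hop {f f' : R.Face} (hsub : R.boundary f ⊆ R.boundary f') (hne : f ≠ f') (d : G.Dart)
      (hd : R.face d = f) : R.face d.symm = f' :=
    (R.mem_boundary_iff.1 (hsub ⟨d, hd, rfl⟩)).resolve_left fun h1 => hne (hd.symm.trans h1)
  obtain ⟨d, hd, hd'⟩ := h.exists_face_symm_ne (hop hff'.ge (Ne.symm hne))
  exact hd' (hop hff'.le hne d hd)

lemma exists_isDartCycle_boundary [Finite V] (h : R.IsRainbow col) (f : R.Face) :
    ∃ d : ZMod t → G.Dart, IsDartCycle col d ∧ dartEdges d = R.boundary f := by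
  obtain ⟨n, _, d, hinj, hrange, hd⟩ := R.exists_cyclic_enumeration f
  have hface (i) : R.face (d i) = f := hrange.le ⟨i, rfl⟩
  have hbij : Function.Bijective fun i => col (d i).fst := by
    refine ⟨fun i j hij => hinj (h.eq_of_fst ((hface i).trans (hface j).symm) hij), fun c => ?_⟩
    obtain ⟨a, ⟨ha, rfl⟩, -⟩ := h.existsUnique f c
    obtain ⟨i, rfl⟩ := hrange.ge ha
    exact ⟨i, rfl⟩
  obtain rfl : n = t := by simpa using Nat.card_congr (Equiv.ofBijective _ hbij)
  refine ⟨d, ⟨fun i => by rw [hd, R.facePerm_fst], hbij.1, fun i j hij =>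
    hinj (h.eq_of_edge_eq ((hface i).trans (hface j).symm) hij)⟩, ?_⟩
  rw [dartEdges, Set.range_comp', hrange]
  rfl

lemma ncard_boundary [Finite V] (h : R.IsRainbow col) (f : R.Face) :
    (R.boundary f).ncard = t := by
  obtain ⟨d, hd, hf⟩ := h.exists_isDartCycle_boundary f
  rw [← hf, hd.ncard_dartEdges]

lemma isCycleSet_boundary [Finite V] (h : R.IsRainbow col) {K : Graph (Fin t) (Sym2 V)}
    {X : Set (Sym2 V)} (hK : IsIdentification K G col X) {f : R.Face}
    (hX : ∀ e ∈ R.boundary f, e ∉ X) : K.IsCycleSet (R.boundary f) := by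
  obtain ⟨d, hd, hf⟩ := h.exists_isDartCycle_boundary f
  have : NeZero t := ⟨(col (d 0).fst).pos.ne'⟩
  rw [← hf] at hX ⊢
  exact hd.isCycleSet hK fun i => hX _ ⟨i, rfl⟩

lemma existsUnique_boundary [Finite V] (h : R.IsRainbow col) {f : R.Face} {g : Sym2 V}
    (hg : g ∈ R.boundary f) {v : V} (hv : v ∈ g) :
    ∃! g', g' ∈ R.boundary f ∧ g' ≠ g ∧ v ∈ g' := by
  obtain ⟨a, b, ha, hb, rfl, hbv⟩ := R.exists_face_snd_fst hg hv
  have hab : a.edge ≠ b.edge := fun he => by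
    obtain rfl := h.eq_of_edge_eq (ha.trans hb.symm) he
    exact a.adj.ne hbv
  have hva : a.snd ∈ a.edge := Sym2.mem_mk_right _ _
  have hvb : a.snd ∈ b.edge := hbv ▸ Sym2.mem_mk_left _ _
  have eq_or_eq : ∀ g ∈ R.boundary f, a.snd ∈ g → g = a.edge ∨ g = b.edge := by
    rintro _ ⟨d, hd, rfl⟩ hv
    rcases Sym2.mem_iff.1 hv with hv | hv
    · exact Or.inr (congrArg _ (h.eq_of_fst (hd.trans hb.symm) (by rw [hbv]; exact hv ▸ rfl)))
    · exact Or.inl (congrArg _ (h.eq_of_snd (hd.trans ha.symm) (congrArg col hv.symm)))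
  rcases eq_or_eq g hg hv with rfl | rfl
  · exact ⟨b.edge, ⟨⟨b, hb, rfl⟩, hab.symm, hvb⟩,
      fun g' ⟨h1, h2, h3⟩ => (eq_or_eq g' h1 h3).resolve_left h2⟩
  · exact ⟨a.edge, ⟨⟨a, ha, rfl⟩, hab, hva⟩,
      fun g' ⟨h1, h2, h3⟩ => (eq_or_eq g' h1 h3).resolve_right h2⟩

end RotationSystem.IsRainbow

end Rainbow

/-! ### Orientation of cycles -/

section Orientation

variable {V α : Type*} {G : SimpleGraph V} {c : V → α} {n : ℕ} {d : ZMod n → G.Dart}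
  {A : Set G.Dart}

/-- The darts in `A` leave distinct vertices, enter distinct vertices and have distinct edges once
vertices are identified according to `c`, as do the darts along an oriented cycle. -/
structure IsCoherent (c : V → α) (A : Set G.Dart) : Prop where
  fst_injOn : A.InjOn fun a => c a.fst
  snd_injOn : A.InjOn fun a => c a.snd
  edge_injOn : A.InjOn SimpleGraph.Dart.edge

namespace IsDartCycle

/-- Consecutive darts of a cycle agree on whether they or their reverses lie in a coherent set. -/
lemma forall_mem_or_forall_symm_mem [NeZero n] (hd : IsDartCycle c d) (hA : IsCoherent c A)
    (hmem : ∀ i, d i ∈ A ∨ (d i).symm ∈ A) : (∀ i, d i ∈ A) ∨ ∀ i, (d i).symm ∈ A := by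
  have hne (i) : d (i + 1) ≠ (d i).symm := fun hi => by
    have h1 : i + 1 = i := hd.edge_injective (by simp [hi])
    exact (d i).symm_ne (hi.symm.trans (congrArg d h1))
  have hall {p : ZMod n → Prop} (h0 : p 0) (hstep : ∀ i, p i → p (i + 1)) (i) : p i := by
    rw [← ZMod.natCast_zmod_val i]
    induction i.val with
    | zero => simpa using h0
    | succ k ih => simpa using hstep _ ih
  rcases hmem 0 with h0 | h0
  · refine Or.inl (hall h0 fun i hi => (hmem (i + 1)).resolve_right fun h1 => hne i ?_)
    rw [← hA.snd_injOn h1 hi (hd.link i).symm, SimpleGraph.Dart.symm_symm]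
  · exact Or.inr (hall h0 fun i hi => (hmem (i + 1)).resolve_left fun h1 =>
      hne i (hA.fst_injOn h1 hi (hd.link i).symm))

lemma range_eq_or_range_symm_eq [NeZero n] (hd : IsDartCycle c d) (hA : IsCoherent c A)
    (hdA : dartEdges d = SimpleGraph.Dart.edge '' A) :
    Set.range d = A ∨ Set.range (fun i => (d i).symm) = A := by
  have hmem (i) : d i ∈ A ∨ (d i).symm ∈ A := by
    obtain ⟨a, ha, hai⟩ := hdA.le ⟨i, rfl⟩
    rcases (SimpleGraph.dart_edge_eq_iff _ _).1 hai with rfl | rfl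
    · exact Or.inl ha
    · exact Or.inr ha
  have hsub {D : ZMod n → G.Dart} (hD : ∀ i, D i ∈ A) (hDd : ∀ i, (D i).edge = (d i).edge) :
      Set.range D = A := by
    refine (Set.range_subset_iff.2 hD).antisymm fun a ha => ?_
    obtain ⟨i, hi⟩ := hdA.ge ⟨a, ha, rfl⟩
    exact ⟨i, hA.edge_injOn (hD i) ha ((hDd i).trans hi)⟩
  exact (hd.forall_mem_or_forall_symm_mem hA hmem).imp (hsub · fun _ => rfl)
    (hsub · fun i => (d i).edge_symm)

lemma abs_sum_eq [NeZero n] (hd : IsDartCycle c d) (hA : IsCoherent c A)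
    (hdA : dartEdges d = SimpleGraph.Dart.edge '' A) {ψ : G.Dart → ℤ}
    (hψ : ∀ d, ψ d.symm = -ψ d) : |∑ i, ψ (d i)| = |∑ᶠ a ∈ A, ψ a| := by
  rcases hd.range_eq_or_range_symm_eq hA hdA with rfl | rfl
  · rw [finsum_mem_range hd.injective, finsum_eq_sum_of_fintype]
  · have hinj : Function.Injective fun i => (d i).symm :=
      SimpleGraph.Dart.symm_involutive.injective.comp hd.injective
    rw [finsum_mem_range hinj, finsum_eq_sum_of_fintype,
      Finset.sum_congr rfl fun i _ => hψ (d i), Finset.sum_neg_distrib, abs_neg]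

lemma isClosedVia_of_coherent [NeZero n] (hd : IsDartCycle c d) (hA : IsCoherent c A)
    (hdA : dartEdges d = SimpleGraph.Dart.edge '' A) {β : Type*} {q : V → β}
    (hq : ∀ a ∈ A, ∀ b ∈ A, c a.snd = c b.fst → q a.snd = q b.fst) : IsClosedVia q d := by
  rcases hd.range_eq_or_range_symm_eq hA hdA with rfl | rfl
  · exact fun i => hq _ ⟨i, rfl⟩ _ ⟨i + 1, rfl⟩ (hd.link i)
  · exact fun i => (hq _ ⟨i + 1, rfl⟩ _ ⟨i, rfl⟩ (hd.link i).symm).symm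

end IsDartCycle

end Orientation

section Chain

variable {V α : Type*} {G : SimpleGraph V}

lemma exists_isPath_of_chain (D : ℕ → G.Dart) {n : ℕ}
    (hlink : ∀ j < n, (D j).snd = (D (j + 1)).fst)
    (hinj : Set.InjOn (fun j => (D j).fst) (Set.Iic n)) :
    ∃ p : G.Walk (D 0).fst (D n).fst, p.IsPath ∧ p.length = n ∧
      ∀ e, e ∈ p.edges ↔ ∃ j < n, (D j).edge = e := by
  suffices h : ∃ p : G.Walk (D 0).fst (D n).fst, p.length = n ∧
      (∀ v ∈ p.support, ∃ j ≤ n, (D j).fst = v) ∧ p.IsPath ∧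
      ∀ e, e ∈ p.edges ↔ ∃ j < n, (D j).edge = e by
    obtain ⟨p, h1, -, h2, h3⟩ := h
    exact ⟨p, h2, h1, h3⟩
  induction n with
  | zero => exact ⟨.nil, rfl, by simp, .nil, by simp⟩
  | succ n ih =>
    obtain ⟨p, hlen, hsupp, hpath, hedges⟩ := ih (fun j hj => hlink j (by omega))
      (hinj.mono (Set.Iic_subset_Iic.2 n.le_succ))
    have hadj : G.Adj (D n).fst (D (n + 1)).fst := hlink n n.lt_succ_self ▸ (D n).adj
    have hedge : s((D n).fst, (D (n + 1)).fst) = (D n).edge := by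
      rw [← hlink n n.lt_succ_self]; rfl
    refine ⟨p.concat hadj, by simp [hlen], fun v hv => ?_, hpath.concat (fun hv => ?_) hadj,
      fun e => ?_⟩
    · rcases (by simpa using hv : v ∈ p.support ∨ v = (D (n + 1)).fst) with hv | rfl
      · obtain ⟨j, hj, rfl⟩ := hsupp v hv
        exact ⟨j, by omega, rfl⟩
      · exact ⟨n + 1, le_rfl, rfl⟩
    · obtain ⟨j, hj, hj'⟩ := hsupp _ hv
      have : j = n + 1 := hinj (Set.mem_Iic.2 (by omega)) Set.self_mem_Iic hj'
      omega
    · simp only [SimpleGraph.Walk.edges_concat, List.concat_eq_append, List.mem_append, hedges,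
        hedge, List.mem_singleton, Nat.lt_succ_iff_lt_or_eq, or_and_right, exists_or,
        exists_eq_left, eq_comm (a := e)]

lemma exists_isCycle_of_chain (D : ℕ → G.Dart) {n : ℕ}
    (hlink : ∀ j < n, (D j).snd = (D (j + 1)).fst) (hclose : (D n).snd = (D 0).fst)
    (hinj : Set.InjOn (fun j => (D j).fst) (Set.Iic n))
    (hedge : ∀ j < n, (D j).edge ≠ (D n).edge) :
    ∃ (v : V) (w : G.Walk v v), w.IsCycle ∧ w.length = n + 1 ∧
      {e | e ∈ w.edges} = (fun j => (D j).edge) '' Set.Iic n := by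
  obtain ⟨p, hp, hlen, hedges⟩ := exists_isPath_of_chain D hlink hinj
  have hadj : G.Adj (D n).fst (D 0).fst := hclose ▸ (D n).adj
  have hn : s((D n).fst, (D 0).fst) = (D n).edge := by rw [← hclose]; rfl
  refine ⟨_, .cons hadj p, (SimpleGraph.Walk.cons_isCycle_iff p hadj).2 ⟨hp, fun he => ?_⟩,
    by simp [hlen], ?_⟩
  · obtain ⟨j, hj, hj'⟩ := (hedges _).1 he
    exact hedge j hj (hj'.trans hn)
  · ext e
    simp only [SimpleGraph.Walk.edges_cons, List.mem_cons, hedges, hn, Set.mem_ofPred_eq,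
      Set.mem_image, Set.mem_Iic, Nat.le_iff_lt_or_eq, or_and_right, exists_or, exists_eq_left,
      eq_comm (a := e), or_comm]

lemma IsDartCycle.exists_isCycle {c : V → α} {n : ℕ} [NeZero n] {d : ZMod n → G.Dart}
    (hd : IsDartCycle c d) (hclosed : IsClosedVia id d) :
    ∃ (v : V) (w : G.Walk v v), w.IsCycle ∧ w.length = n ∧ {e | e ∈ w.edges} = dartEdges d := by
  obtain ⟨m, rfl⟩ := Nat.exists_eq_succ_of_ne_zero (NeZero.ne n)
  have hinj := natCast_zmod_injOn (m + 1)
  have hlt : Set.Iic m = Set.Iio (m + 1) := by ext; simp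
  rw [dartEdges_eq_image, ← hlt]
  refine exists_isCycle_of_chain (fun j : ℕ => d j) (fun j _ => ?_) ?_ ?_ fun j hj he => ?_
  · simpa using hclosed j
  · simpa [← Nat.cast_succ] using hclosed m
  · rw [hlt]
    exact fun i hi j hj hij => hinj hi hj (hd.fst_injective (congrArg c hij))
  · exact hj.ne (hinj (Set.mem_Iio.2 (by omega)) (Set.mem_Iio.2 (by omega)) (hd.edge_injective he))

end Chain

/-! ### Flows in the dual graph -/

section Flow

variable {V : Type*} {G : SimpleGraph V}

open Classical in
/-- The unit flow that crosses the edge of the dart `a`, from the face of `a` to that of its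
reverse. -/
noncomputable def unitFlow (a d : G.Dart) : ℤ :=
  (if d = a then 1 else 0) - if d = a.symm then 1 else 0

open Classical in
lemma unitFlow_symm (a d : G.Dart) : unitFlow a d.symm = -unitFlow a d := by
  have h1 : d.symm = a ↔ d = a.symm := SimpleGraph.Dart.symm_involutive.eq_iff
  have h2 : d.symm = a.symm ↔ d = a := SimpleGraph.Dart.symm_involutive.injective.eq_iff
  simp only [unitFlow, h1, h2, neg_sub]

namespace RotationSystem

variable (R : RotationSystem G)

/-- The net outflow from the face `f` of a function on darts, seen as a flow in the dual graph. -/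
noncomputable def faceSum (ψ : G.Dart → ℤ) (f : R.Face) : ℤ := ∑ᶠ a ∈ {a | R.face a = f}, ψ a

variable [Finite V]

open Classical in
lemma faceSum_unitFlow (a : G.Dart) (f : R.Face) :
    R.faceSum (unitFlow a) f =
      (if R.face a = f then 1 else 0) - if R.face a.symm = f then 1 else 0 := by
  have := Fintype.ofFinite G.Dart
  have hsum (b : G.Dart) : ∑ d, (if R.face d = f then if d = b then (1 : ℤ) else 0 else 0) =
      if R.face b = f then 1 else 0 := by
    rw [Fintype.sum_eq_single b fun d hd => by simp [hd], if_pos rfl]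
  simp only [faceSum, Set.mem_ofPred_eq, finsum_eq_if, finsum_eq_sum_of_fintype, unitFlow, ← hsum,
    ← Finset.sum_sub_distrib]
  refine Finset.sum_congr rfl fun d _ => ?_
  split_ifs <;> rfl

lemma faceSum_add (ψ₁ ψ₂ : G.Dart → ℤ) (f : R.Face) :
    R.faceSum (ψ₁ + ψ₂) f = R.faceSum ψ₁ f + R.faceSum ψ₂ f :=
  finsum_mem_add_distrib (Set.toFinite _)

open Classical in
lemma exists_flow (hG : G.Connected) (f₁ f₂ : R.Face) :
    ∃ ψ : G.Dart → ℤ, (∀ d, ψ d.symm = -ψ d) ∧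
      ∀ f, R.faceSum ψ f = (if f₁ = f then 1 else 0) - if f₂ = f then 1 else 0 := by
  refine R.face_mem_of_closed hG (X := {f₂ | ∃ ψ : G.Dart → ℤ, (∀ d, ψ d.symm = -ψ d) ∧
    ∀ f, R.faceSum ψ f = (if f₁ = f then 1 else 0) - if f₂ = f then 1 else 0}) (f := f₁)
    ⟨0, by simp, by simp [faceSum]⟩ ?_ f₂
  rintro d ⟨ψ, hψ, hs⟩
  refine ⟨ψ + unitFlow d, fun x => ?_, fun f => ?_⟩
  · rw [Pi.add_apply, Pi.add_apply, hψ, unitFlow_symm, neg_add]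
  · rw [faceSum_add, hs, faceSum_unitFlow, sub_add_sub_cancel]

end RotationSystem

namespace RotationSystem.IsRainbow

variable [Finite V] {R : RotationSystem G} {t : ℕ} {col : V → Fin t}

lemma exists_mem_boundary_notMem (h : R.IsRainbow col) {f f' : R.Face} (hne : f ≠ f') :
    ∃ e ∈ R.boundary f, e ∉ R.boundary f' := by
  by_contra! hsub
  exact hne (h.boundary_injective (Set.eq_of_subset_of_ncard_le hsub
    (by rw [h.ncard_boundary, h.ncard_boundary]) (Set.toFinite _)))

open Classical in
/-- Among the faces next to a given edge, only `o` sends out flow. If `o` is one of them, the flow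
leaves through an edge that does not border the other one. -/
lemma exists_flow_avoiding (h : R.IsRainbow col) (o : R.Face) (ε : G.Dart) :
    ∃ ψ : G.Dart → ℤ, (∀ d, ψ d.symm = -ψ d) ∧ (∀ d, d.edge = ε.edge → ψ d = 0) ∧
      ∀ f, ε.edge ∈ R.boundary f → R.faceSum ψ f = if o = f then 1 else 0 := by
  by_cases hε : ε.edge ∈ R.boundary o
  swap
  · refine ⟨0, by simp, by simp, fun f hf => ?_⟩
    rw [if_neg (by rintro rfl; exact hε hf)]
    simp [RotationSystem.faceSum]
  obtain ⟨d, rfl, hdε⟩ := hε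
  obtain ⟨-, ⟨a, ha, rfl⟩, ha'⟩ := h.exists_mem_boundary_notMem (h.face_symm_ne d).symm
  have hnot : R.face a ≠ R.face d.symm ∧ R.face a.symm ≠ R.face d.symm := by
    rwa [R.mem_boundary_iff, not_or] at ha'
  have hane : a.edge ≠ d.edge := fun he => ha' (he ▸ R.mem_boundary_iff.2 (Or.inr rfl))
  refine ⟨unitFlow a, unitFlow_symm a, fun x hx => ?_, fun f hf => ?_⟩
  · rw [unitFlow, if_neg, if_neg, sub_zero]
    · rintro rfl
      exact hane (a.edge_symm ▸ hx.trans hdε.symm)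
    · rintro rfl
      exact hane (hx.trans hdε.symm)
  · rw [R.faceSum_unitFlow]
    rw [← hdε, R.mem_boundary_iff] at hf
    rcases hf with rfl | rfl
    · rw [if_pos ha, if_pos rfl, if_neg (ha ▸ h.face_symm_ne a), sub_zero]
    · rw [if_neg hnot.1, if_neg hnot.2, if_neg (h.face_symm_ne d).symm, sub_zero]

end RotationSystem.IsRainbow

end Flow

/-! ### Labelling the minors -/

section Minors

variable {V α : Type*} {G : SimpleGraph V}

/-- Think of `rim f C` as: `C` is what the minor `K` retains of the boundary of the face `f`. -/
lemma IsIdentification.labellable_of_faces {K : Graph α (Sym2 V)} {c : V → α} {X : Set (Sym2 V)}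
    (hK : IsIdentification K G c X) [Finite G.Dart] {β Φ : Type*} [Finite β] {q : V → β}
    (hq : ∀ a b, q a = q b → c a = c b) {ψ : G.Dart → ℤ} (hψ : ∀ d, ψ d.symm = -ψ d)
    {𝓑 : Set (Set (Sym2 V))} (h𝓑 : ∀ C ∈ 𝓑, K.IsCycleSet C) {rim : Φ → Set (Sym2 V) → Prop}
    {o : Φ}
    (hrim : ∀ (n : ℕ) [NeZero n] (d : ZMod n → G.Dart), IsDartCycle c d → (∀ i, (d i).edge ∉ X) →
      (IsClosedVia q d ↔ ∃ f, rim f (dartEdges d)) ∧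
      (∀ f, rim f (dartEdges d) →
        |∑ i, ψ (d i)| = open Classical in if o = f then 1 else 0) ∧
      (dartEdges d ∈ 𝓑 ↔ ∃ f, o ≠ f ∧ rim f (dartEdges d)))
    (Γ : Type*) [Group Γ] [Infinite Γ] : K.Labellable 𝓑 Γ := by
  refine hK.labellable_of_winding hq hψ h𝓑 (fun n _ d hd hX hcl => ?_)
    (fun n _ d hd hX => ?_) Γ
  · obtain ⟨hclosed, hsum, -⟩ := hrim n d hd hX
    obtain ⟨f, hf⟩ := hclosed.1 hcl
    rw [hsum f hf]
    split_ifs <;> simp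
  · obtain ⟨hclosed, hsum, hmem⟩ := hrim n d hd hX
    rw [hmem, hclosed]
    constructor
    · rintro ⟨f, hof, hf⟩
      exact ⟨⟨f, hf⟩, abs_eq_zero.1 ((hsum f hf).trans (if_neg hof))⟩
    · rintro ⟨⟨f, hf⟩, h0⟩
      refine ⟨f, fun hof => ?_, hf⟩
      have h1 := hsum f hf
      rw [if_pos hof, h0] at h1
      simp at h1

open Classical in
/-- The map that identifies `y` with `x`, as in the definition of contraction. -/
noncomputable def identify (x y z : α) : α := if z = y then x else z

lemma identify_eq_iff {x y a b : α} :
    identify x y a = identify x y b ↔ a = b ∨ (a ∈ s(x, y) ∧ b ∈ s(x, y)) := by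
  simp only [identify, Sym2.mem_iff]
  grind

lemma IsIdentification.contract {K : Graph α (Sym2 V)} {c : V → α}
    (hK : IsIdentification K G c ∅) (e : Sym2 V) (x y : α) :
    IsIdentification (K.contract e x y) G (identify x y ∘ c) {e} := by
  rw [← Set.empty_union {e}]
  exact (hK.deleteEdges {e}).map (identify x y)

namespace IsDartCycle

variable {c : V → α} {n : ℕ} [NeZero n] {d : ZMod n → G.Dart}

lemma exists_isCycle_of_gap (hd : IsDartCycle c d) {b : G.Dart}
    (hlink : ∀ i, i ≠ -1 → (d i).snd = (d (i + 1)).fst) (hfst : b.fst = (d (-1)).snd)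
    (hsnd : b.snd = (d 0).fst) (hb : ∀ i, (d i).edge ≠ b.edge) :
    ∃ (v : V) (w : G.Walk v v), w.IsCycle ∧ w.length = n + 1 ∧
      {e | e ∈ w.edges} = insert b.edge (dartEdges d) := by
  have hn : 0 < n := NeZero.pos n
  have hinj := natCast_zmod_injOn n
  have hne (i) : (d i).fst ≠ b.fst := fun hi => by
    have h0 : c (d i).fst = c (d 0).fst := by rw [hi, hfst, hd.link, neg_add_cancel]
    obtain rfl := hd.fst_injective h0
    exact b.adj.ne (hi.symm.trans hsnd.symm)
  have hlast {j : ℕ} (hj : j < n) : (j : ZMod n) = -1 ↔ j + 1 = n := by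
    rw [eq_neg_iff_add_eq_zero, ← Nat.cast_succ, ZMod.natCast_eq_zero_iff]
    exact ⟨fun h => (Nat.le_of_dvd j.succ_pos h).antisymm' hj, fun h => h ▸ dvd_rfl⟩
  let D (j : ℕ) : G.Dart := if j < n then d j else b
  have hD {j : ℕ} (hj : j < n) : D j = d j := if_pos hj
  have hDn : D n = b := if_neg (lt_irrefl n)
  have hIic : Set.Iic n = insert n (Set.Iio n) := (Set.Iio_insert).symm
  have himage : (fun j => (D j).edge) '' Set.Iic n = insert b.edge (dartEdges d) := by
    rw [hIic, Set.image_insert_eq, hDn, dartEdges_eq_image]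
    exact congrArg _ (Set.image_congr fun j hj => by rw [hD hj])
  rw [← himage]
  refine exists_isCycle_of_chain D (fun j hj => ?_) ?_ ?_ fun j hj => ?_
  · rcases Nat.lt_or_ge (j + 1) n with hj' | hj'
    · rw [hD hj, hD hj', Nat.cast_succ, hlink _ fun h => hj'.ne ((hlast hj).1 h)]
    · obtain rfl : j + 1 = n := by omega
      rw [hD hj, hDn, hfst, (hlast hj).2 rfl]
  · rw [hDn, hD hn, hsnd, Nat.cast_zero]
  · rw [hIic, Set.injOn_insert (by simp)]
    refine ⟨fun i hi j hj hij => hinj hi hj (hd.fst_injective (congrArg c ?_)), ?_⟩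
    · rwa [← hD hi, ← hD hj]
    · rintro ⟨j, hj, hj'⟩
      exact hne j (by rwa [← hDn, ← hD hj])
  · rw [hD hj, hDn]
    exact hb j

/-- A cycle of the contraction that is open in `G` has exactly one gap, which the contracted edge
closes. -/
lemma exists_isCycle_insert (hd : IsDartCycle c d) {ε : G.Dart} (hε : c ε.fst = c ε.snd)
    (hne : ∀ i, (d i).edge ≠ ε.edge) (hclosed : IsClosedVia (identify ε.fst ε.snd) d)
    (hopen : ¬IsClosedVia id d) :
    ∃ (v : V) (w : G.Walk v v), w.IsCycle ∧ w.length = n + 1 ∧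
      {e | e ∈ w.edges} = insert ε.edge (dartEdges d) := by
  obtain ⟨k, hk⟩ : ∃ k, (d k).snd ≠ (d (k + 1)).fst := not_forall.1 hopen
  have hgap {i} (hi : (d i).snd ≠ (d (i + 1)).fst) :
      (d i).snd ∈ ε.edge ∧ (d (i + 1)).fst ∈ ε.edge :=
    (identify_eq_iff.1 (hclosed i)).resolve_left hi
  obtain ⟨b, hb, hfst, hsnd⟩ : ∃ b : G.Dart, b.edge = ε.edge ∧ b.fst = (d k).snd ∧
      b.snd = (d (k + 1)).fst := by
    have he : s((d k).snd, (d (k + 1)).fst) = ε.edge :=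
      ((Sym2.mem_and_mem_iff hk).1 (hgap hk)).symm
    exact ⟨⟨((d k).snd, (d (k + 1)).fst), G.mem_edgeSet.1 (he ▸ ε.edge_mem)⟩, he, rfl, rfl⟩
  have hc {v : V} (hv : v ∈ ε.edge) : c v = c ε.fst := by
    rcases Sym2.mem_iff.1 hv with rfl | rfl
    · rfl
    · exact hε.symm
  have hunique {i} (hi : (d i).snd ≠ (d (i + 1)).fst) : i = k :=
    add_right_cancel (hd.fst_injective ((hc (hgap hi).2).trans (hc (hgap hk).2).symm))
  rw [← hb, ← dartEdges_shift d (k + 1)]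
  refine (hd.shift (k + 1)).exists_isCycle_of_gap (fun i hi => ?_) ?_ ?_ fun i => hb ▸ hne _
  · by_contra hi'
    rw [add_right_comm] at hi'
    exact hi (eq_neg_of_add_eq_zero_left (by linear_combination hunique hi'))
  · rw [hfst, add_comm k, neg_add_cancel_left]
  · rw [hsnd, zero_add]

end IsDartCycle

namespace RotationSystem

variable {R : RotationSystem G} {t : ℕ} {col : V → Fin t}

/-- The edge sets of the boundaries of the faces other than `o`. -/
def boundariesExcept (R : RotationSystem G) (o : R.Face) : Set (Set (Sym2 V)) :=
  {C | ∃ f, f ≠ o ∧ C = R.boundary f}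

/-- Every cycle of length at most `t` bounds a face. -/
def ShortCyclesBound (R : RotationSystem G) (t : ℕ) : Prop :=
  ∀ (v : V) (w : G.Walk v v), w.IsCycle → w.length ≤ t →
    ∃ f : R.Face, {e | e ∈ w.edges} = R.boundary f

namespace IsRainbow

variable [Finite V]

lemma isCoherent_face (h : R.IsRainbow col) (f : R.Face) :
    IsCoherent col {a | R.face a = f} where
  fst_injOn _ ha _ hb := h.eq_of_fst (ha.trans hb.symm)
  snd_injOn _ ha _ hb := h.eq_of_snd (ha.trans hb.symm)
  edge_injOn _ ha _ hb := h.eq_of_edge_eq (ha.trans hb.symm)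

lemma isClosedVia_of_dartEdges_eq (h : R.IsRainbow col) {n : ℕ} [NeZero n] {d : ZMod n → G.Dart}
    (hd : IsDartCycle col d) {f : R.Face} (hf : dartEdges d = R.boundary f) :
    IsClosedVia id d := by
  refine hd.isClosedVia_of_coherent (h.isCoherent_face f) hf fun a ha b hb hab => ?_
  rw [← h.facePerm_eq_of_link (ha.trans hb.symm) hab, R.facePerm_fst]

lemma isClosedVia_id_iff (h : R.IsRainbow col) (hshort : R.ShortCyclesBound t) {n : ℕ} [NeZero n]
    {d : ZMod n → G.Dart} (hd : IsDartCycle col d) :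
    IsClosedVia id d ↔ ∃ f, dartEdges d = R.boundary f := by
  refine ⟨fun hcl => ?_, fun ⟨f, hf⟩ => h.isClosedVia_of_dartEdges_eq hd hf⟩
  obtain ⟨v, w, hw, hlen, hedges⟩ := hd.exists_isCycle hcl
  have hn : n ≤ t := by simpa using Fintype.card_le_of_injective _ hd.fst_injective
  rw [← hedges]
  exact hshort v w hw (hlen.trans_le hn)

lemma labellable_delete (h : R.IsRainbow col) (hshort : R.ShortCyclesBound t) (o : R.Face)
    (ε : G.Dart) (Γ : Type*) [Group Γ] [Infinite Γ] :
    ((G.identifyColours col).deleteEdges {ε.edge}).Labellable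
      (Graph.deleteBalanced (R.boundariesExcept o) ε.edge) Γ := by
  obtain ⟨ψ, hψ, hs⟩ := R.exists_flow h.connected o (R.face ε)
  have hK := (isIdentification_ofSimpleGraph_map (G := G) col).deleteEdges {ε.edge}
  refine hK.labellable_of_faces (q := id) (rim := fun f C => C = R.boundary f) (o := o)
    (fun _ _ => congrArg col) hψ ?_ (fun n _ d hd hX => ?_) Γ
  · rintro _ ⟨⟨f, -, rfl⟩, hε⟩
    refine h.isCycleSet_boundary hK fun e he => ?_
    rintro (he' | rfl)
    · exact he'
    · exact hε he
  have hε : ε.edge ∉ dartEdges d := fun ⟨i, hi⟩ => hX i (Or.inr hi)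
  refine ⟨h.isClosedVia_id_iff hshort hd, fun f hf => ?_, ?_⟩
  · have hne : R.face ε ≠ f := fun hεf => hε (hf ▸ ⟨ε, hεf, rfl⟩)
    rw [hd.abs_sum_eq (h.isCoherent_face f) hf hψ, ← RotationSystem.faceSum, hs, if_neg hne,
      sub_zero]
    split_ifs <;> rfl
  · simp only [Graph.deleteBalanced, boundariesExcept, Set.mem_ofPred_eq, hε, not_false_eq_true,
      and_true, ne_comm]

lemma isCoherent_contract (h : R.IsRainbow col) {b ε : G.Dart} (hb : b.edge = ε.edge) :
    IsCoherent (identify (col ε.fst) (col ε.snd) ∘ col) ({a | R.face a = R.face b} \ {b}) := by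
  have hmem {v : V} (hv : col v ∈ s(col ε.fst, col ε.snd)) :
      col v = col b.fst ∨ col v = col b.snd :=
    Sym2.mem_iff.1 (congrArg (Sym2.map col) hb ▸ hv : col v ∈ b.edge.map col)
  refine ⟨fun a ha a' ha' haa' => ?_, fun a ha a' ha' haa' => ?_,
    (h.isCoherent_face _).edge_injOn.mono Set.sdiff_subset⟩
  · have hne {a} (ha : a ∈ {a | R.face a = R.face b} \ {b}) : col a.fst ≠ col b.fst :=
      fun hc => ha.2 (h.eq_of_fst ha.1 hc)
    refine h.eq_of_fst (ha.1.trans ha'.1.symm) ((identify_eq_iff.1 haa').elim id fun hs => ?_)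
    exact ((hmem hs.1).resolve_left (hne ha)).trans ((hmem hs.2).resolve_left (hne ha')).symm
  · have hne {a} (ha : a ∈ {a | R.face a = R.face b} \ {b}) : col a.snd ≠ col b.snd :=
      fun hc => ha.2 (h.eq_of_snd ha.1 hc)
    refine h.eq_of_snd (ha.1.trans ha'.1.symm) ((identify_eq_iff.1 haa').elim id fun hs => ?_)
    exact ((hmem hs.1).resolve_right (hne ha)).trans ((hmem hs.2).resolve_right (hne ha')).symm

lemma exists_dartEdges_eq_image (h : R.IsRainbow col) {ε : G.Dart} {n : ℕ} {d : ZMod n → G.Dart}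
    (hne : ∀ i, (d i).edge ≠ ε.edge) {f : R.Face}
    (hf : insert ε.edge (dartEdges d) = R.boundary f) :
    ∃ b : G.Dart, R.face b = f ∧ b.edge = ε.edge ∧
      dartEdges d = SimpleGraph.Dart.edge '' ({a | R.face a = R.face b} \ {b}) := by
  obtain ⟨b, rfl, hb⟩ := hf.le (Set.mem_insert _ _)
  refine ⟨b, rfl, hb, ?_⟩
  have himage : SimpleGraph.Dart.edge '' {a | R.face a = R.face b} =
      insert ε.edge (dartEdges d) := hf.symm
  rw [(h.isCoherent_face _).edge_injOn.image_sdiff_subset (Set.singleton_subset_iff.2 rfl), himage,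
    Set.image_singleton, hb, Set.insert_sdiff_self_of_notMem]
  rintro ⟨i, hi⟩
  exact hne i hi

lemma isClosedVia_of_insert_eq_boundary (h : R.IsRainbow col) {ε : G.Dart} {n : ℕ} [NeZero n]
    {d : ZMod n → G.Dart} (hd : IsDartCycle (identify (col ε.fst) (col ε.snd) ∘ col) d)
    (hne : ∀ i, (d i).edge ≠ ε.edge) {f : R.Face}
    (hf : insert ε.edge (dartEdges d) = R.boundary f) :
    IsClosedVia (identify ε.fst ε.snd) d := by
  obtain ⟨b, rfl, hb, hdb⟩ := h.exists_dartEdges_eq_image hne hf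
  refine hd.isClosedVia_of_coherent (h.isCoherent_contract hb) hdb ?_
  rintro a ⟨ha, hab⟩ a' ⟨ha', hab'⟩ haa'
  refine identify_eq_iff.2 ((identify_eq_iff.1 haa').imp (fun hcol => ?_) fun hcol => ?_)
  · rw [← h.facePerm_eq_of_link (ha.trans ha'.symm) hcol, R.facePerm_fst]
  · change a.snd ∈ ε.edge ∧ a'.fst ∈ ε.edge
    change col a.snd ∈ ε.edge.map col ∧ col a'.fst ∈ ε.edge.map col at hcol
    rw [← hb] at hcol ⊢
    have h1 : col a.snd = col b.fst :=
      (Sym2.mem_iff.1 hcol.1).resolve_right fun hc => hab (h.eq_of_snd ha hc)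
    have h2 : col a'.fst = col b.snd :=
      (Sym2.mem_iff.1 hcol.2).resolve_left fun hc => hab' (h.eq_of_fst ha' hc)
    rw [← R.facePerm_fst, h.facePerm_eq_of_link ha h1,
      ← h.facePerm_eq_of_link ha'.symm h2.symm, R.facePerm_fst]
    exact ⟨Sym2.mem_mk_left _ _, Sym2.mem_mk_right _ _⟩

omit [Finite V] in
lemma lt_of_isDartCycle_contract (h : R.IsRainbow col) {ε : G.Dart} {n : ℕ} [NeZero n]
    {d : ZMod n → G.Dart} (hd : IsDartCycle (identify (col ε.fst) (col ε.snd) ∘ col) d) :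
    n < t := by
  have hmiss : col ε.snd ∉ Set.range
      fun i => (identify (col ε.fst) (col ε.snd) ∘ col) (d i).fst := by
    rintro ⟨i, hi⟩
    simp only [Function.comp_apply, identify] at hi
    split_ifs at hi with hi'
    · exact h.col_fst_ne ε hi
    · exact hi' hi
  simpa using Fintype.card_lt_of_injective_of_notMem _ hd.fst_injective hmiss

lemma isClosedVia_identify_iff (h : R.IsRainbow col) (hshort : R.ShortCyclesBound t)
    {ε : G.Dart} {n : ℕ} [NeZero n] {d : ZMod n → G.Dart}
    (hd : IsDartCycle (identify (col ε.fst) (col ε.snd) ∘ col) d)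
    (hne : ∀ i, (d i).edge ≠ ε.edge) :
    IsClosedVia (identify ε.fst ε.snd) d ↔ ∃ f, insert ε.edge (dartEdges d) = R.boundary f := by
  refine ⟨fun hcl => ?_, fun ⟨f, hf⟩ => h.isClosedVia_of_insert_eq_boundary hd hne hf⟩
  have hn : n < t := h.lt_of_isDartCycle_contract hd
  by_cases hopen : IsClosedVia id d
  · obtain ⟨v, w, hw, hlen, hedges⟩ := hd.exists_isCycle hopen
    obtain ⟨f, hf⟩ := hshort v w hw (by omega)
    have hcard := h.ncard_boundary f
    rw [← hf, hedges, hd.ncard_dartEdges] at hcard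
    exact absurd hcard hn.ne
  · have hε : identify (col ε.fst) (col ε.snd) (col ε.fst) =
        identify (col ε.fst) (col ε.snd) (col ε.snd) := identify_eq_iff.2 (Or.inr (by simp))
    obtain ⟨v, w, hw, hlen, hedges⟩ := hd.exists_isCycle_insert hε hne hcl hopen
    rw [← hedges]
    exact hshort v w hw (by omega)

lemma labellable_contract (h : R.IsRainbow col) (hshort : R.ShortCyclesBound t) (o : R.Face)
    (ε : G.Dart) (Γ : Type*) [Group Γ] [Infinite Γ] :
    ((G.identifyColours col).contract ε.edge (col ε.fst) (col ε.snd)).Labellable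
      ((G.identifyColours col).contractBalanced (R.boundariesExcept o) ε.edge (col ε.fst)
        (col ε.snd)) Γ := by
  obtain ⟨ψ, hψ, hψε, hs⟩ := h.exists_flow_avoiding o ε
  have hK := (isIdentification_ofSimpleGraph_map (G := G) col).contract ε.edge (col ε.fst)
    (col ε.snd)
  refine hK.labellable_of_faces (q := identify ε.fst ε.snd)
    (rim := fun f C => insert ε.edge C = R.boundary f) (o := o) (fun a b hab => ?_) hψ
    (fun C hC => hC.1) (fun n _ d hd hX => ?_) Γ
  · exact identify_eq_iff.2 ((identify_eq_iff.1 hab).imp (congrArg col) fun hab =>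
      ⟨Sym2.mem_map.2 ⟨a, hab.1, rfl⟩, Sym2.mem_map.2 ⟨b, hab.2, rfl⟩⟩)
  refine ⟨h.isClosedVia_identify_iff hshort hd hX, fun f hf => ?_, fun hC => ?_, ?_⟩
  · rw [← hs f (hf ▸ Set.mem_insert _ _)]
    obtain ⟨b, rfl, hb, hdb⟩ := h.exists_dartEdges_eq_image hX hf
    have hsum : ∑ᶠ a ∈ {a | R.face a = R.face b} \ {b}, ψ a = R.faceSum ψ (R.face b) :=
      finsum_mem_inter_support_eq' _ _ _ fun a ha =>
        and_iff_left fun hab => ha (hab ▸ hψε b hb)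
    rw [hd.abs_sum_eq (h.isCoherent_contract hb) hdb hψ, hsum, hs _ (hf ▸ Set.mem_insert _ _)]
    split_ifs <;> rfl
  · rcases hC.2 with ⟨f, -, hf⟩ | ⟨f, hof, hf⟩
    · have hcard := h.ncard_boundary f
      rw [← hf, hd.ncard_dartEdges] at hcard
      exact absurd hcard (h.lt_of_isDartCycle_contract hd).ne
    · exact ⟨f, hof.symm, hf⟩
  · rintro ⟨f, hof, hf⟩
    exact ⟨hd.isCycleSet hK hX, Or.inr ⟨f, hof.symm, hf⟩⟩

end IsRainbow

end RotationSystem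

end Minors

/-! ### Simple connectedness -/

section SpanningTree

variable {V X : Type*} {G : SimpleGraph V} {side : G.Dart → X} {r : X}

lemma exists_adj_dist_lt {D : SimpleGraph X} {x y : X} (h : D.Reachable x y) (hne : x ≠ y) :
    ∃ z, D.Adj x z ∧ D.dist z y < D.dist x y := by
  obtain ⟨p, hp⟩ := h.exists_walk_length_eq_dist
  cases p with
  | nil => exact absurd rfl hne
  | cons hadj p => exact ⟨_, hadj, hp ▸ (SimpleGraph.dist_le p).trans_lt (Nat.lt_succ_self _)⟩

/-- A spanning tree with root `r` in the graph with vertex set `X` in which every dart `d` of `G`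
leads from `side d` to `side d.symm`: each vertex other than the root has a dart to its parent, and
ranks decrease towards the root. For `side` the initial vertex of a dart this is a spanning tree of
`G`, for `side` the face of a dart one of the dual graph. -/
structure SpanningTree (side : G.Dart → X) (r : X) where
  /-- A height function. -/
  rank : X → ℕ
  /-- The dart to the parent. -/
  dart : {x // x ≠ r} → G.Dart
  side_dart : ∀ x, side (dart x) = x
  rank_lt : ∀ x, rank (side (dart x).symm) < rank x

namespace SpanningTree

/-- The edges of `G` that the tree uses. -/
def edges (T : SpanningTree side r) : Set (Sym2 V) := Set.range fun x => (T.dart x).edge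

lemma edge_mem_edges_iff (T : SpanningTree side r) {d : G.Dart} :
    d.edge ∈ T.edges ↔ ∃ x, d = T.dart x ∨ d = (T.dart x).symm :=
  exists_congr fun _ => eq_comm.trans (SimpleGraph.dart_edge_eq_iff _ _)

lemma edge_dart_injective (T : SpanningTree side r) :
    Function.Injective fun x => (T.dart x).edge := by
  intro x y hxy
  rcases (SimpleGraph.dart_edge_eq_iff _ _).1 hxy with h | h
  · exact Subtype.ext (by rw [← T.side_dart, h, T.side_dart])
  · have hx := T.rank_lt x
    have hy := T.rank_lt y
    rw [h, SimpleGraph.Dart.symm_symm, T.side_dart] at hx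
    rw [← h, T.side_dart] at hy
    exact absurd hx hy.not_gt

lemma ncard_edges_add_one [Finite X] (T : SpanningTree side r) :
    T.edges.ncard + 1 = Nat.card X := by
  rw [edges, Set.ncard_range_of_injective T.edge_dart_injective, ← Set.ncard_univ X,
    ← Set.ncard_sdiff_singleton_add_one (Set.mem_univ r), Set.sdiff_eq, Set.univ_inter,
    ← Nat.card_coe_set_eq]
  rfl

lemma exists_forall_eq (T : SpanningTree side r) {Γ : Type*} [Nonempty Γ]
    (F : {x // x ≠ r} → Γ → Γ) :
    ∃ g : X → Γ, ∀ x : {x // x ≠ r}, g x = F x (g (side (T.dart x).symm)) := by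
  classical
  refine ⟨(measure T.rank).wf.fix fun x ih => if hx : x ≠ r then
    F ⟨x, hx⟩ (ih _ (T.rank_lt ⟨x, hx⟩)) else Classical.arbitrary Γ, fun x => ?_⟩
  rw [WellFounded.fix_eq, dif_pos x.2]

lemma leaf_induction [Finite X] (T : SpanningTree side r) {p : X → Prop}
    (h : ∀ x, (∀ y, T.rank x < T.rank y → p y) → p x) (x : X) : p x := by
  have : IsTrans X fun y x => T.rank x < T.rank y := ⟨fun _ _ _ h₁ h₂ => h₂.trans h₁⟩
  have : Std.Irrefl fun y x => T.rank x < T.rank y := ⟨fun _ => lt_irrefl _⟩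
  exact (Finite.wellFounded_of_trans_of_irrefl fun y x => T.rank x < T.rank y).induction x h

lemma exists_edges_subset {A : Set (Sym2 V)}
    (h : ∀ S : Set X, r ∈ S → (∀ d, d.edge ∈ A → side d ∈ S → side d.symm ∈ S) → ∀ x, x ∈ S) :
    ∃ T : SpanningTree side r, T.edges ⊆ A := by
  let D : SimpleGraph X :=
    SimpleGraph.fromRel fun x y => ∃ d : G.Dart, d.edge ∈ A ∧ side d = x ∧ side d.symm = y
  have hreach : ∀ x, D.Reachable x r := h {x | D.Reachable x r} (.refl _) fun d hd hr => by
    by_cases hne : side d.symm = side d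
    · rwa [hne]
    · have hadj : D.Adj (side d.symm) (side d) :=
        (SimpleGraph.fromRel_adj _ _ _).2 ⟨hne, Or.inr ⟨d, hd, rfl, rfl⟩⟩
      exact hadj.reachable.trans hr
  have hparent (x : {x // x ≠ r}) :
      ∃ d : G.Dart, d.edge ∈ A ∧ side d = x ∧ D.dist (side d.symm) r < D.dist x r := by
    obtain ⟨y, hadj, hlt⟩ := exists_adj_dist_lt (hreach x) x.2
    obtain ⟨-, ⟨d, hd, hx, rfl⟩ | ⟨d, hd, rfl, hx⟩⟩ := (SimpleGraph.fromRel_adj _ _ _).1 hadj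
    · exact ⟨d, hd, hx, hlt⟩
    · exact ⟨d.symm, by rwa [d.edge_symm], hx, by rwa [d.symm_symm]⟩
  choose dart hA hside hlt using hparent
  exact ⟨⟨fun x => D.dist x r, dart, hside, hlt⟩, Set.range_subset_iff.2 hA⟩

lemma exists_of_connected (hG : G.Connected) (v : V) :
    Nonempty (SpanningTree (fun d : G.Dart => d.fst) v) := by
  obtain ⟨T, -⟩ := exists_edges_subset (side := fun d : G.Dart => d.fst) (r := v) (A := Set.univ)
    fun S hv hS => mem_of_dart_closed hG hv fun d => hS d trivial
  exact ⟨T⟩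

variable {Γ : Type*} [Group Γ]

lemma exists_gauge {v : V} (T : SpanningTree (fun d : G.Dart => d.fst) v) (ℓ : G.Dart → Γ) :
    ∃ g : V → Γ, ∀ x, (g (T.dart x).fst)⁻¹ * ℓ (T.dart x) * g (T.dart x).snd = 1 := by
  obtain ⟨g, hg⟩ := T.exists_forall_eq fun x (γ : Γ) => ℓ (T.dart x) * γ
  refine ⟨g, fun x => ?_⟩
  rw [T.side_dart, hg, mul_assoc]
  exact inv_mul_cancel _

/-- A tree does not separate the faces: leaves are crossed by going around them. -/
lemma face_symm_mem [Finite V] {R : RotationSystem G} {v : V}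
    (T : SpanningTree (fun d : G.Dart => d.fst) v) {S : Set R.Face}
    (hS : ∀ d : G.Dart, d.edge ∉ T.edges → R.face d ∈ S → R.face d.symm ∈ S) (d : G.Dart)
    (hd : R.face d ∈ S) : R.face d.symm ∈ S := by
  suffices H : ∀ v, ∀ d : G.Dart, d.fst = v → (R.face d ∈ S ↔ R.face d.symm ∈ S) from
    (H _ d rfl).1 hd
  refine T.leaf_induction fun v ih => ?_
  have hother (d : G.Dart) (hd : d.fst = v) (hne : ∀ x, d ≠ T.dart x) :
      R.face d ∈ S ↔ R.face d.symm ∈ S := by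
    by_cases hT : d.edge ∈ T.edges
    · obtain ⟨x, rfl | rfl⟩ := T.edge_mem_edges_iff.1 hT
      · exact absurd rfl (hne x)
      · rw [SimpleGraph.Dart.symm_symm]
        exact (ih x (hd ▸ T.rank_lt x) _ (T.side_dart x)).symm
    · refine ⟨hS d hT, fun h => ?_⟩
      have := hS d.symm (by rwa [d.edge_symm]) h
      rwa [d.symm_symm] at this
  intro d hd
  by_cases hx : ∃ x, d = T.dart x
  · obtain ⟨x, rfl⟩ := hx
    rw [← R.face_next]
    refine R.next_induction (p := fun y => y.fst = v ∧ (R.face y ∈ S ↔ R.face (R.next _) ∈ S))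
      (d := R.next (T.dart x)) ⟨(R.fst_next _).trans hd, Iff.rfl⟩ ?_ (R.fst_next _).symm |>.2
    rintro y ⟨hy, hyS⟩
    refine ⟨(R.fst_next y).trans hy, ?_⟩
    by_cases hyx : y = T.dart x
    · rw [hyx]
    · rw [R.face_next, ← hother y hy fun x' hx' => hyx ?_, hyS]
      rw [hx', Subtype.ext (a1 := x') (a2 := x)]
      rw [← T.side_dart, ← T.side_dart x, hd, ← hy, hx']
  · exact hother d hd (not_exists.1 hx)

lemma exists_dual [Finite V] (hG : G.Connected) {R : RotationSystem G} {v : V}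
    (T : SpanningTree (fun d : G.Dart => d.fst) v) (o : R.Face) :
    ∃ T' : SpanningTree R.face o, T'.edges ⊆ G.edgeSet \ T.edges :=
  exists_edges_subset fun _ ho hS => R.face_mem_of_closed hG ho
    (T.face_symm_mem fun d hd => hS d ⟨d.edge_mem, hd⟩)

lemma edges_union_eq_edgeSet [Finite V] (P : PlaneEmbedding G) {v : V} {o : P.Face}
    (T : SpanningTree (fun d : G.Dart => d.fst) v) (T' : SpanningTree P.face o)
    (hT' : T'.edges ⊆ G.edgeSet \ T.edges) : T.edges ∪ T'.edges = G.edgeSet := by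
  refine Set.eq_of_subset_of_ncard_le (Set.union_subset ?_ (hT'.trans Set.sdiff_subset)) ?_
  · exact Set.range_subset_iff.2 fun x => (T.dart x).edge_mem
  · have heuler := P.euler
    rw [Set.ncard_union_eq (Set.disjoint_sdiff_right.mono_right hT'),
      ← Nat.card_coe_set_eq G.edgeSet]
    have := T.ncard_edges_add_one
    have := T'.ncard_edges_add_one
    omega

end SpanningTree

end SpanningTree

section NotLabellable

variable {V : Type*} {G : SimpleGraph V}

namespace RotationSystem

variable (R : RotationSystem G) {Γ : Type*} [Group Γ]

/-- A closed walk that traverses every boundary edge of the face `f` once has value `1` in the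
labelling `ℓ` of the darts. -/
def IsBalancedFace (ℓ : G.Dart → Γ) (f : R.Face) : Prop :=
  ∃ (n : ℕ) (_ : NeZero n) (d : ZMod n → G.Dart), IsDartCycle id d ∧ dartEdges d = R.boundary f ∧
    cyclicProd (fun i => ℓ (d i)) = 1

variable {R} {ℓ : G.Dart → Γ}

lemma isBalancedFace_gauge_iff (g : V → Γ) {f : R.Face} :
    R.IsBalancedFace (fun d => (g d.fst)⁻¹ * ℓ d * g d.snd) f ↔ R.IsBalancedFace ℓ f := by
  refine exists_congr fun n => exists_congr fun _ => exists_congr fun d => and_congr_right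
    fun hd => and_congr_right fun _ => ?_
  rw [← gapWord_eq_cyclicProd hd.link ℓ g]
  exact cyclicProd_gauge_eq_one_iff id ℓ d g

lemma IsBalancedFace.eq_one (hℓ : ∀ d, ℓ d.symm = (ℓ d)⁻¹) {a : G.Dart}
    (ha : R.IsBalancedFace ℓ (R.face a))
    (h : ∀ b, R.face b = R.face a → b.edge ≠ a.edge → ℓ b = 1) : ℓ a = 1 := by
  obtain ⟨n, _, d, hd, hedges, hprod⟩ := ha
  have eq_one_symm {b} : ℓ b.symm = 1 ↔ ℓ b = 1 := by rw [hℓ, inv_eq_one]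
  obtain ⟨j, hj⟩ : a.edge ∈ dartEdges d := hedges ▸ ⟨a, rfl, rfl⟩
  have hdj : ℓ (d j) = 1 := by
    refine eq_of_cyclicProd_eq (F := fun i => ℓ (d i)) (F' := fun _ => 1) (fun i hij => ?_)
      (hprod.trans (by simp [cyclicProd]))
    have hne : (d i).edge ≠ a.edge := fun hi => hij (hd.edge_injective (hi.trans hj.symm))
    have hmem : (d i).edge ∈ R.boundary (R.face a) := hedges ▸ ⟨i, rfl⟩
    rcases R.mem_boundary_iff.1 hmem with hi | hi
    · exact h _ hi hne
    · exact eq_one_symm.1 (h _ hi ((d i).edge_symm ▸ hne))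
  rcases (SimpleGraph.dart_edge_eq_iff _ _).1 hj with rfl | hja
  · exact hdj
  · rwa [hja, eq_one_symm] at hdj

lemma eq_one_of_isBalancedFace [Finite V] (hℓ : ∀ d, ℓ d.symm = (ℓ d)⁻¹) {A : Set (Sym2 V)}
    (hA : ∀ d, d.edge ∈ A → ℓ d = 1) {o : R.Face} (T : SpanningTree R.face o)
    (hT : G.edgeSet ⊆ A ∪ T.edges) (hbal : ∀ f, f ≠ o → R.IsBalancedFace ℓ f) (d : G.Dart) :
    ℓ d = 1 := by
  have eq_one_symm {b} : ℓ b.symm = 1 ↔ ℓ b = 1 := by rw [hℓ, inv_eq_one]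
  have hdart : ∀ (f) (hf : f ≠ o), ℓ (T.dart ⟨f, hf⟩) = 1 := by
    refine T.leaf_induction fun f ih hf => ?_
    have hface : R.face (T.dart ⟨f, hf⟩) = f := T.side_dart ⟨f, hf⟩
    refine IsBalancedFace.eq_one hℓ (by rw [hface]; exact hbal f hf) fun b hb hne => ?_
    rw [hface] at hb
    rcases hT b.edge_mem with hbA | hbT
    · exact hA b hbA
    · obtain ⟨x, rfl | rfl⟩ := T.edge_mem_edges_iff.1 hbT
      · obtain rfl : x = ⟨f, hf⟩ := Subtype.ext ((T.side_dart x).symm.trans hb)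
        exact absurd rfl hne
      · exact eq_one_symm.2 (ih x (hb ▸ T.rank_lt x) x.2)
  rcases hT d.edge_mem with hd | hd
  · exact hA d hd
  · obtain ⟨x, rfl | rfl⟩ := T.edge_mem_edges_iff.1 hd
    · exact hdart x x.2
    · exact eq_one_symm.2 (hdart x x.2)

end RotationSystem

/-- The sphere minus a point is simply connected. -/
lemma PlaneEmbedding.exists_gauge_eq_one [Finite V] (P : PlaneEmbedding G) {Γ : Type*} [Group Γ]
    {ℓ : G.Dart → Γ} (hℓ : ∀ d, ℓ d.symm = (ℓ d)⁻¹) {o : P.Face}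
    (hbal : ∀ f, f ≠ o → P.IsBalancedFace ℓ f) :
    ∃ g : V → Γ, ∀ d, (g d.fst)⁻¹ * ℓ d * g d.snd = 1 := by
  obtain ⟨v⟩ := P.connected.nonempty
  obtain ⟨T⟩ := SpanningTree.exists_of_connected P.connected v
  obtain ⟨T', hT'⟩ := T.exists_dual P.connected o
  obtain ⟨g, hg⟩ := T.exists_gauge ℓ
  have hsymm (d : G.Dart) : (g d.symm.fst)⁻¹ * ℓ d.symm * g d.symm.snd =
      ((g d.fst)⁻¹ * ℓ d * g d.snd)⁻¹ := by simp [hℓ, mul_assoc]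
  refine ⟨g, RotationSystem.eq_one_of_isBalancedFace hsymm (A := T.edges) (fun d hd => ?_) T'
    (T.edges_union_eq_edgeSet P T' hT').ge fun f hf =>
      (RotationSystem.isBalancedFace_gauge_iff g).2 (hbal f hf)⟩
  obtain ⟨x, rfl | rfl⟩ := T.edge_mem_edges_iff.1 hd
  · exact hg x
  · rw [hsymm, hg, inv_one]

lemma stepGain_eq_inv {α Γ : Type*} [Group Γ] {K : Graph α (Sym2 V)} (φ : K.GroupLabelling Γ)
    {e : E(K)} {u v : α} (h : K.IsLink e u v) (hne : u ≠ v) :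
    stepGain φ v e = (stepGain φ u e)⁻¹ := by
  obtain ⟨z, hz⟩ := φ.inc_tail e
  simp only [stepGain]
  rcases hz.left_eq_or_eq h with htail | htail
  · rw [htail, if_pos rfl, if_neg hne.symm]
  · rw [htail, if_pos rfl, if_neg hne, inv_inv]

lemma IsIdentification.exists_lift {α : Type*} {K : Graph α (Sym2 V)} {c : V → α}
    (hK : IsIdentification K G c ∅) (hc : ∀ d : G.Dart, c d.fst ≠ c d.snd) {Γ : Type*} [Group Γ]
    (φ : K.GroupLabelling Γ) :
    ∃ ℓ : G.Dart → Γ, (∀ d, ℓ d.symm = (ℓ d)⁻¹) ∧ LiftsGain c φ ℓ := by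
  have hlink (d : G.Dart) : K.IsLink d.edge (c d.fst) (c d.snd) :=
    (hK _ _ _).2 ⟨id, d, rfl, rfl, rfl⟩
  refine ⟨fun d => stepGain φ (c d.fst) ⟨d.edge, (hlink d).edge_mem⟩, fun d => ?_,
    fun e u v h => ?_⟩
  · simp only [d.edge_symm]
    exact stepGain_eq_inv φ (hlink d) (hc d)
  · obtain ⟨-, d, rfl, rfl, rfl⟩ := (hK _ _ _).1 h
    exact ⟨d, rfl, rfl, rfl, rfl⟩

namespace RotationSystem.IsRainbow

variable [Finite V] {R : RotationSystem G} {t : ℕ} {col : V → Fin t}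

lemma isDartCycle_id (h : R.IsRainbow col) {n : ℕ} [NeZero n] {d : ZMod n → G.Dart}
    (hd : IsDartCycle col d) {f : R.Face} (hf : dartEdges d = R.boundary f) :
    IsDartCycle id d where
  link := h.isClosedVia_of_dartEdges_eq hd hf
  fst_injective := .of_comp (f := col) hd.fst_injective
  edge_injective := hd.edge_injective

lemma isBalancedFace (h : R.IsRainbow col) {K : Graph (Fin t) (Sym2 V)} {Γ : Type*} [Group Γ]
    {φ : K.GroupLabelling Γ} {ℓ : G.Dart → Γ} (hφ : LiftsGain col φ ℓ) {f : R.Face}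
    (hf : R.boundary f ∈ φ.balanced) : R.IsBalancedFace ℓ f := by
  obtain ⟨u, p, hp, hpf, hgain⟩ := hf
  obtain ⟨n, _, d, hd, hedges, hprod⟩ := hφ.exists_isDartCycle hp
  exact ⟨n, ‹_›, d, h.isDartCycle_id hd (hedges.trans hpf), hedges.trans hpf, hprod.trans hgain⟩

end RotationSystem.IsRainbow

theorem PlaneEmbedding.not_labellable [Finite V] (P : PlaneEmbedding G) {t : ℕ} {col : V → Fin t}
    (h : P.IsRainbow col) (Γ : Type*) [Group Γ] :
    ¬ (G.identifyColours col).Labellable P.finiteFaces Γ := by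
  rintro ⟨φ, hφ⟩
  have hK : IsIdentification (G.identifyColours col) G col ∅ :=
    isIdentification_ofSimpleGraph_map col
  obtain ⟨ℓ, hℓ, hφℓ⟩ := hK.exists_lift h.col_fst_ne φ
  obtain ⟨g, hg⟩ := P.exists_gauge_eq_one hℓ (o := P.outer) fun f hf =>
    h.isBalancedFace hφℓ (hφ ▸ ⟨f, hf, rfl⟩)
  have houter : P.boundary P.outer ∈ φ.balanced := by
    obtain ⟨u, p, hp, hpf⟩ := h.isCycleSet_boundary hK (f := P.outer) fun _ _ => id
    obtain ⟨n, _, d, hd, hedges, hprod⟩ := hφℓ.exists_isDartCycle hp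
    have hcl := h.isClosedVia_of_dartEdges_eq hd (hedges.trans hpf)
    refine ⟨u, p, hp, hpf, ?_⟩
    rw [← hprod, ← gapWord_eq_cyclicProd hcl ℓ g, ← cyclicProd_gauge_eq_one_iff id]
    simp [hg, cyclicProd]
  obtain ⟨f, hf, hff⟩ := hφ.le houter
  exact hf (h.boundary_injective hff).symm

end NotLabellable

/-! ### Theta subgraphs -/

section Theta

variable {α β : Type*} {K : Graph α β} {x y : α} {p q r : K.Walk x y}

lemma length_support_eq (p : K.Walk x y) : p.support.length = p.edges.length + 1 := by
  induction p with
  | nil => rfl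
  | cons _ _ _ ih => rw [Graph.Walk.support, Graph.Walk.edges, List.length_cons, ih,
      List.length_cons]

lemma internallyDisjoint_comm : p.InternallyDisjoint q ↔ q.InternallyDisjoint p :=
  and_congr ⟨fun h e hq hp => h e hp hq, fun h e hp hq => h e hq hp⟩
    (forall_congr' fun _ => imp.swap)

lemma length_add_length_le_of_isPath [DecidableEq α] (hp : p.IsPath) (hq : q.IsPath)
    (hpq : p.InternallyDisjoint q) :
    p.edges.length + q.edges.length ≤ (p.support.toFinset ∪ q.support.toFinset).card := by
  have hunion := Finset.card_union_add_card_inter p.support.toFinset q.support.toFinset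
  rw [List.toFinset_card_of_nodup hp, List.toFinset_card_of_nodup hq, length_support_eq,
    length_support_eq] at hunion
  have hinter : (p.support.toFinset ∩ q.support.toFinset).card ≤ 2 := by
    refine (Finset.card_le_card (t := {x, y}) fun z hz => ?_).trans Finset.card_le_two
    simp only [Finset.mem_inter, List.mem_toFinset] at hz
    simpa using hpq.2 z hz.1 hz.2
  omega

lemma exists_edgeSet_eq_singleton_of_support (hxy : x ≠ y) (hr : r.IsPath)
    (h : ∀ z ∈ r.support, z = x ∨ z = y) : ∃ e, r.edgeSet = {e} := by
  classical
  have hlen : r.support.length ≤ 2 := by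
    rw [← List.toFinset_card_of_nodup hr]
    refine (Finset.card_le_card (t := {x, y}) fun z hz => ?_).trans Finset.card_le_two
    simpa using h z (by simpa using hz)
  rw [length_support_eq] at hlen
  cases r with
  | nil => exact absurd rfl hxy
  | cons e he p =>
    have hnil : p.edges = [] := List.eq_nil_of_length_eq_zero (by
      simpa [Graph.Walk.edges] using hlen)
    exact ⟨e, by ext; simp [Graph.Walk.edgeSet, Graph.Walk.edges, hnil]⟩

lemma ncard_edgeSet_union_le (p q : K.Walk x y) :
    (p.edgeSet ∪ q.edgeSet).ncard ≤ p.edges.length + q.edges.length := by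
  classical
  have hunion : p.edgeSet ∪ q.edgeSet = ((p.edges ++ q.edges).toFinset : Set β) := by
    ext; simp [Graph.Walk.edgeSet]
  rw [hunion, Set.ncard_coe_finset, ← List.length_append]
  exact List.toFinset_card_le _

lemma exists_edgeSet_eq_singleton_of_card_le [Finite α] (hxy : x ≠ y) (hp : p.IsPath)
    (hq : q.IsPath) (hr : r.IsPath) (hpq : p.InternallyDisjoint q) (hpr : p.InternallyDisjoint r)
    (hqr : q.InternallyDisjoint r) (hcard : Nat.card α ≤ (p.edgeSet ∪ q.edgeSet).ncard) :
    ∃ e, r.edgeSet = {e} := by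
  classical
  have := Fintype.ofFinite α
  rw [Nat.card_eq_fintype_card] at hcard
  have huniv : p.support.toFinset ∪ q.support.toFinset = Finset.univ :=
    (Finset.card_eq_iff_eq_univ _).1 (le_antisymm (Finset.card_le_univ _)
      ((hcard.trans (ncard_edgeSet_union_le p q)).trans
        (length_add_length_le_of_isPath hp hq hpq)))
  refine exists_edgeSet_eq_singleton_of_support hxy hr fun z hz => ?_
  have hmem : z ∈ p.support.toFinset ∪ q.support.toFinset := huniv ▸ Finset.mem_univ z
  rw [Finset.mem_union, List.mem_toFinset, List.mem_toFinset] at hmem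
  exact hmem.elim (hpr.2 z · hz) (hqr.2 z · hz)

end Theta

section Biased

variable {V : Type*} [Finite V] {G : SimpleGraph V}

namespace RotationSystem.IsRainbow

variable {R : RotationSystem G} {t : ℕ} {col : V → Fin t}

lemma mem_of_insert_eq_boundary (h : R.IsRainbow col) {A : Set (Sym2 V)} {e₁ e₂ : Sym2 V}
    (he₁ : e₁ ∉ A) {f₁ f₂ : R.Face} (h₁ : insert e₁ A = R.boundary f₁)
    (h₂ : insert e₂ A = R.boundary f₂) {v : V} (hv : v ∈ e₁) : v ∈ e₂ := by
  have he₁f : e₁ ∈ R.boundary f₁ := h₁ ▸ Set.mem_insert _ _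
  obtain ⟨g, ⟨hg, hge, hvg⟩, -⟩ := h.existsUnique_boundary he₁f hv
  have hgA : g ∈ A := (h₁ ▸ hg : g ∈ insert e₁ A).resolve_left hge
  have hgf : g ∈ R.boundary f₂ := h₂ ▸ Set.mem_insert_of_mem _ hgA
  obtain ⟨g', ⟨hg', hge', hvg'⟩, -⟩ := h.existsUnique_boundary hgf hvg
  rcases (h₂ ▸ hg' : g' ∈ insert e₂ A) with rfl | hgA'
  · exact hvg'
  · have hgf' : g' ∈ R.boundary f₁ := h₁ ▸ Set.mem_insert_of_mem _ hgA'
    obtain rfl : g' = e₁ := (h.existsUnique_boundary hg hvg).unique ⟨hgf', hge', hvg'⟩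
      ⟨he₁f, hge.symm, hv⟩
    exact absurd hgA' he₁

lemma eq_of_insert_eq_boundary (h : R.IsRainbow col) {A : Set (Sym2 V)} {e₁ e₂ : Sym2 V}
    (he₁ : e₁ ∉ A) {f₁ f₂ : R.Face} (h₁ : insert e₁ A = R.boundary f₁)
    (h₂ : insert e₂ A = R.boundary f₂) : e₁ = e₂ := by
  have hends : ∀ v ∈ e₁, v ∈ e₂ := fun v => h.mem_of_insert_eq_boundary he₁ h₁ h₂
  obtain ⟨d, -, rfl⟩ : e₁ ∈ R.boundary f₁ := h₁ ▸ Set.mem_insert _ _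
  exact ((Sym2.mem_and_mem_iff d.adj.ne).1
    ⟨hends _ (Sym2.mem_mk_left _ _), hends _ (Sym2.mem_mk_right _ _)⟩).symm

/-- Two cycles of a theta subgraph that bound faces are spanning, so each of the two paths they do
not share is a single edge. -/
lemma edgeSet_union_ne_boundary (h : R.IsRainbow col) {K : Graph (Fin t) (Sym2 V)} {x y : Fin t}
    {p q r : K.Walk x y} (hxy : x ≠ y) (hp : p.IsPath) (hq : q.IsPath) (hr : r.IsPath)
    (hpq : p.InternallyDisjoint q) (hpr : p.InternallyDisjoint r) (hqr : q.InternallyDisjoint r)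
    {f₁ f₂ : R.Face} (h₁ : p.edgeSet ∪ q.edgeSet = R.boundary f₁) :
    p.edgeSet ∪ r.edgeSet ≠ R.boundary f₂ := by
  intro h₂
  have hcard (f : R.Face) : Nat.card (Fin t) ≤ (R.boundary f).ncard := by
    rw [h.ncard_boundary, Nat.card_fin]
  obtain ⟨e₁, hq₁⟩ := exists_edgeSet_eq_singleton_of_card_le hxy hp hr hq hpr hpq
    (internallyDisjoint_comm.1 hqr) (h₂ ▸ hcard f₂)
  obtain ⟨e₂, hr₂⟩ := exists_edgeSet_eq_singleton_of_card_le hxy hp hq hr hpq hpr hqr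
    (h₁ ▸ hcard f₁)
  rw [hq₁, Set.union_singleton] at h₁
  rw [hr₂, Set.union_singleton] at h₂
  have he₁ : e₁ ∈ q.edgeSet := hq₁ ▸ Set.mem_singleton _
  have he₂ : e₂ ∈ r.edgeSet := hr₂ ▸ Set.mem_singleton _
  obtain rfl := h.eq_of_insert_eq_boundary (fun hp₁ => hpq.1 _ hp₁ he₁) h₁ h₂
  exact hqr.1 _ he₁ he₂

theorem isBiased (h : R.IsRainbow col) (o : R.Face) :
    (G.identifyColours col).IsBiased (R.boundariesExcept o) where
  isCycleSet := by
    rintro _ ⟨f, -, rfl⟩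
    exact h.isCycleSet_boundary (isIdentification_ofSimpleGraph_map col) fun _ _ => id
  theta := by
    rintro x y p q r hxy hp hq hr hpq hpr hqr ⟨f₁, -, h₁⟩ ⟨f₂, -, h₂⟩
    exact absurd h₂ (h.edgeSet_union_ne_boundary hxy hp hq hr hpq hpr hqr h₁)

end RotationSystem.IsRainbow

end Biased

/-! ### Subdivisions -/

section Subdivision

variable {α β α' β' : Type*} {H : Graph α' β'} {x : α'}

lemma two_lt_encard_adj_of_isThreeConnected (hH : H.IsThreeConnected) (hx : x ∈ V(H)) :
    2 < {y | H.Adj x y}.encard := by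
  have := hH.loopless
  by_contra! hle
  obtain ⟨y, hy, hyx⟩ : ∃ y ∈ V(H), y ∉ insert x {y | H.Adj x y} := by
    by_contra! hsub
    have hfour : (4 : ℕ∞) ≤ 2 + 1 := hH.four_le_card.trans <| (Set.encard_le_encard hsub).trans <|
      (Set.encard_insert_le _ _).trans <| add_le_add_left hle 1
    norm_num at hfour
  rw [Set.mem_insert_iff, not_or] at hyx
  obtain ⟨p⟩ := hH.connected _ hle x ⟨hx, H.not_adj_self x⟩ y ⟨hy, hyx.2⟩
  cases p with
  | nil => exact hyx.1 rfl
  | cons e h p =>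
    rw [Graph.deleteVerts_isLink] at h
    exact h.2.2 ⟨e, h.1⟩

lemma exists_inc_left {K : Graph α β} {u v : α} (huv : u ≠ v) (p : K.Walk u v) :
    ∃ e ∈ p.edges, K.Inc e u := by
  cases p with
  | nil => exact absurd rfl huv
  | cons e h p => exact ⟨e, List.mem_cons_self, _, h⟩

lemma exists_inc_right {K : Graph α β} {u v : α} (huv : u ≠ v) (p : K.Walk u v) :
    ∃ e ∈ p.edges, K.Inc e v := by
  induction p with
  | nil => exact absurd rfl huv
  | @cons u v w e h p ih =>
    by_cases hvw : v = w
    · exact ⟨e, List.mem_cons_self, _, hvw ▸ h.symm⟩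
    · obtain ⟨f, hf, hi⟩ := ih hvw
      exact ⟨f, List.mem_cons_of_mem _ hf, hi⟩

lemma exists_inc_branch [H.Loopless] {K : Graph α β} (S : K.Subdivision H) {f : E(H)}
    (hx : H.Inc f x) : ∃ e ∈ (S.path f).edges, K.Inc e (S.branch x) := by
  have hl := S.isLink f
  have hne : S.branch (S.left f) ≠ S.branch (S.right f) := fun he =>
    hl.ne (S.branch_injOn hl.left_mem hl.right_mem he)
  obtain ⟨y, hy⟩ := hx
  rcases hy.left_eq_or_eq hl with rfl | rfl
  · exact exists_inc_left hne _
  · exact exists_inc_right hne _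

lemma encard_adj_le_of_subdivision [H.Loopless] {G : SimpleGraph α}
    (S : (Graph.ofSimpleGraph G).Subdivision H) :
    {y | H.Adj x y}.encard ≤ (G.neighborSet (S.branch x)).encard := by
  have hstep (y : {y | H.Adj x y}) : ∃ f : E(H), H.IsLink f x y ∧
      ∃ w, G.Adj (S.branch x) w ∧ s(S.branch x, w) ∈ (S.path f).edges := by
    obtain ⟨f, hf⟩ := y.2
    obtain ⟨e, he, w, rfl, hw⟩ := exists_inc_branch S (f := ⟨f, hf.edge_mem⟩) ⟨_, hf⟩
    exact ⟨_, hf, w, hw, he⟩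
  choose f hf w hw hwf using hstep
  refine Function.Embedding.encard_le ⟨fun y => ⟨w y, hw y⟩, fun y z hyz => ?_⟩
  have hfyz : f y = f z := by
    by_contra hne
    exact S.edges_disjoint _ _ hne _ (hwf y) (Subtype.mk.inj hyz ▸ hwf z)
  exact Subtype.ext ((hf y).right_unique (hfyz ▸ hf z))

lemma exists_two_lt_degree_of_subdivision {G : SimpleGraph α} (hH : H.IsThreeConnected)
    (S : (Graph.ofSimpleGraph G).Subdivision H) : ∃ v, 2 < (G.neighborSet v).encard := by
  have := hH.loopless
  obtain ⟨x, hx⟩ : V(H).Nonempty :=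
    Set.encard_pos.1 (lt_of_lt_of_le (by norm_num) hH.four_le_card)
  exact ⟨S.branch x, (two_lt_encard_adj_of_isThreeConnected hH hx).trans_le
    (encard_adj_le_of_subdivision S)⟩

end Subdivision

theorem theorem3p1_general {V : Type*} [Finite V] {t : ℕ} (G : SimpleGraph V)
    (P : PlaneEmbedding G) (col : V → Fin t)
    (hdegree : ∃ v, 2 < (G.neighborSet v).encard)
    (hface : ∀ (f : P.Face) (c : Fin t), ∃! d : G.Dart, P.face d = f ∧ col d.fst = c)
    (hcycle : ∀ (v : V) (w : G.Walk v v), w.IsCycle → w.length ≤ t →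
      ∃ f : P.Face, {e | e ∈ w.edges} = P.boundary f) :
    (G.identifyColours col).IsBiased P.finiteFaces ∧
    (∀ (Γ : Type*) [Group Γ], ¬ (G.identifyColours col).Labellable P.finiteFaces Γ) ∧
    (∀ (e : Sym2 V) (x y : Fin t), (G.identifyColours col).IsLink e x y →
      x ≠ y ∧
      ∀ (Γ : Type*) [Group Γ] [Infinite Γ],
        ((G.identifyColours col).deleteEdges {e}).Labellable
          (Graph.deleteBalanced P.finiteFaces e) Γ ∧
        ((G.identifyColours col).contract e x y).Labellable
          ((G.identifyColours col).contractBalanced P.finiteFaces e x y) Γ) := by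
  have h : P.IsRainbow col := ⟨P.connected, hdegree, hface⟩
  refine ⟨h.isBiased P.outer, fun Γ _ => P.not_labellable h Γ, fun e x y hxy => ?_⟩
  obtain ⟨-, ε, rfl, rfl, rfl⟩ := (isIdentification_ofSimpleGraph_map col _ _ _).1 hxy
  exact ⟨h.col_fst_ne ε, fun Γ _ _ => ⟨h.labellable_delete hcycle P.outer ε Γ,
    h.labellable_contract hcycle P.outer ε Γ⟩⟩

theorem theorem3p1 {V W F : Type*} [Finite V] {t : ℕ} (G : SimpleGraph V) (P : PlaneEmbedding G)
    (col : V → Fin t)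
    -- `G` is a subdivision of a 3-connected graph
    (H : Graph W F) (hH : H.IsThreeConnected) (S : (Graph.ofSimpleGraph G).Subdivision H)
    -- every colour appears exactly once on (the boundary walk of) every face
    (hface : ∀ (f : P.Face) (c : Fin t), ∃! d : G.Dart, P.face d = f ∧ col d.fst = c)
    -- every cycle of length at most `t` is the boundary of a face
    (hcycle : ∀ (v : V) (w : G.Walk v v), w.IsCycle → w.length ≤ t →
      ∃ f : P.Face, {e | e ∈ w.edges} = P.boundary f) :
    (G.identifyColours col).IsBiased P.finiteFaces ∧
    (∀ (Γ : Type*) [Group Γ], ¬ (G.identifyColours col).Labellable P.finiteFaces Γ) ∧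
    (∀ (e : Sym2 V) (x y : Fin t), (G.identifyColours col).IsLink e x y →
      x ≠ y ∧
      ∀ (Γ : Type*) [Group Γ] [Infinite Γ],
        ((G.identifyColours col).deleteEdges {e}).Labellable
          (Graph.deleteBalanced P.finiteFaces e) Γ ∧
        ((G.identifyColours col).contract e x y).Labellable
          ((G.identifyColours col).contractBalanced P.finiteFaces e x y) Γ) := by
  exact theorem3p1_general G P col (exists_two_lt_degree_of_subdivision hH S) hface hcycle
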